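/- **Notation.** The Lee weight of $0,1,2,3\in\mathbb Z_4$ is $0,1,2,1$; for a vector in $\mathbb Z_4^N$ it is the sum over the coordinates, and the Lee distance of $u,v$ is the Lee weight of $u-v$. The Gray map $\mathbb Z_4^N\to\mathbb Z_2^{2N}$ acts coordinatewise by $0\mapsto 00$, $1\mapsto 01$, $2\mapsto 11$, $3\mapsto 10$. A quaternary linear code is a subgroup of $\mathbb Z_4^N$; it is given by a generator matrix $G$ whose rows are divided into rows of order two (entries in $\{0,2\}$) and rows of order four. $G'$ is obtained from $G$ by replacing every $2$ by $1$ in the rows of order two, and $\hat G$ by deleting the rows of order two. A binary code is $\mathbb Z_4$-linear if it is the Gray image of a quaternary linear code. For generator matrices $A,B,C$ of quaternary linear codes of the same length put $$\mathcal{PC}(A,B)=\begin{pmatrix}A&A\\0&B\end{pmatrix},\qquad \mathcal{BQ}(A,B,C)=\begin{pmatrix}A&A&A&A\\0&B'&2B'&3B'\\0&0&\hat B&\hat B\\0&0&0&C\end{pmatrix}.$$ In $\mathcal{PC}(A,B)$ a row has the same order as the row of $A$ or $B$ that it comes from. In $\mathcal{BQ}(A,B,C)$ this holds for the first and the last block row;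 the rows of the two middle block rows have order four. **The family.** For $m\ge1$, $0\le s\le\lfloor (m-1)/2\rfloor$ and $-1\le r\le m$, the code $\mathcal{RM}_s(r,m)\subseteq\mathbb Z_4^{2^{m-1}}$ is generated by the matrix $\mathcal G_s(r,m)$ defined recursively as follows. * $\mathcal G_s(-1,m)$ generates the zero code (no rows of order two or four), $\mathcal G_s(0,m)=(2\cdots2)$ (a row of order two), and $\mathcal G_s(m,m)$ is the identity matrix (rows of order four). * If $0<r<m$ and $s<(m-1)/2$, then $\mathcal G_s(r,m)=\mathcal{PC}(\mathcal G_s(r,m-1),\mathcal G_s(r-1,m-1))$. * If $0<r<m-1$, $m\ge3$ is odd and $s=(m-1)/2$, then $\mathcal G_s(r,m)=\mathcal{BQ}(\mathcal G_{s-1}(r,m-2),\mathcal G_{s-1}(r-1,m-2),\mathcal G_{s-1}(r-2,m-2))$. * If $r=m-1$, $m\ge3$ is odd and $s=(m-1)/2$, then $\mathcal G_s(m-1,m)=\mathcal{BQ}(\mathcal G_{s-1}(m-2,m-2),\mathcal G_{s-1}(m-2,m-2),\mathcal G_{s-1}(m-3,m-2))$. For $N=2^n$ let $K_N$ be the $n$-fold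 Kronecker power of $\begin{pmatrix}1&0\\0&3\end{pmatrix}$ over $\mathbb Z_4$. The Kronecker dual of a code $\mathcal C\subseteq\mathbb Z_4^N$ is $\{u\in\mathbb Z_4^N: uK_Nv^{t}=0\text{ for all }v\in\mathcal C\}$. A Hadamard code of length $n$ is the set of rows, and negatives of rows, of a Hadamard matrix of order $n$, with $1,-1$ written as $0,1$. An extended perfect code is obtained from a perfect $1$-error-correcting binary code by adding an overall parity-check coordinate. **Theorem.** Let $m\ge1$ and $0\le s\le\lfloor (m-1)/2\rfloor$. 1. For $0\le r\le m$ the Gray image of $\mathcal{RM}_s(r,m)$ has length $2^m$. 2. For $0\le r\le m$ the minimum Lee distance of $\mathcal{RM}_s(r,m)$, and the minimum Hamming distance of its Gray image, is $2^{m-r}$. 3. For $0\le r\le m$ the code $\mathcal{RM}_s(r,m)$, and its Gray image, has $2^k$ codewords, where $k=\sum_{i=0}^r\binom mi$. 4. $\mathcal{RM}_s(r-1,m)\subseteq\mathcal{RM}_s(r,m)$ for $0<r\le m$. The code $\mathcal{RM}_s(0,m)$ consists of the zero vector and the all-twos vector, $\mathcal{RM}_s(m,m)=\mathbb Z_4^{2^{m-1}}$,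 and $\mathcal{RM}_s(m-1,m)$ consists of all vectors of even Lee weight. 5. The Gray image of $\mathcal{RM}_s(1,m)$ is a $\mathbb Z_4$-linear Hadamard code, and the Gray image of $\mathcal{RM}_s(m-2,m)$ is a $\mathbb Z_4$-linear extended perfect code. 6. For $-1\le r\le m$ the code $\mathcal{RM}_s(r,m)$ is the Kronecker dual of $\mathcal{RM}_s(m-1-r,m)$. -/

import Mathlib

namespace Z4RM

/-! ### Weights, distances and the Gray map -/

/-- The Lee weight on `ZMod 4`: `0, 1, 2, 1` for `0, 1, 2, 3`. -/
def leeWt (x : ZMod 4) : ℕ := min x.val (4 - x.val)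

/-- The Lee weight of a quaternary vector. -/
def leeWeight {N : ℕ} (u : Fin N → ZMod 4) : ℕ := ∑ i, leeWt (u i)

/-- The Lee distance of two quaternary vectors. -/
def leeDist {N : ℕ} (u v : Fin N → ZMod 4) : ℕ := leeWeight (u - v)

/-- The Gray map on one coordinate: `0 ↦ 00`, `1 ↦ 01`, `2 ↦ 11`, `3 ↦ 10`. -/
def gray (x : ZMod 4) : Fin 2 → ZMod 2 :=
  ![if x = 2 ∨ x = 3 then 1 else 0, if x = 1 ∨ x = 2 then 1 else 0]

/-- The Gray map on vectors: the binary coordinates `2 i` and `2 i + 1` of the image are the two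
coordinates of `gray (v i)`. -/
def grayMap {N : ℕ} (v : Fin N → ZMod 4) : Fin (N * 2) → ZMod 2 :=
  fun j => gray (v j.divNat) j.modNat

/-- The binary image of a quaternary linear code under the Gray map. -/
def grayImage {N : ℕ} (C : AddSubgroup (Fin N → ZMod 4)) : Set (Fin (N * 2) → ZMod 2) :=
  grayMap '' (C : Set (Fin N → ZMod 4))

/-- The length of a binary code. -/
def codeLength {n : ℕ} (_ : Set (Fin n → ZMod 2)) : ℕ := n

/-- `d` is the minimum of the Hamming distances between distinct codewords of `C`. -/
def HasMinHammingDist {n : ℕ} (C : Set (Fin n → ZMod 2)) (d : ℕ) : Prop :=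
  IsLeast {k | ∃ u ∈ C, ∃ v ∈ C, u ≠ v ∧ hammingDist u v = k} d

/-- `d` is the minimum of the Lee distances between distinct codewords of `C`. -/
def HasMinLeeDist {N : ℕ} (C : AddSubgroup (Fin N → ZMod 4)) (d : ℕ) : Prop :=
  IsLeast {k | ∃ u ∈ C, ∃ v ∈ C, u ≠ v ∧ leeDist u v = k} d

/-- A binary code is `ℤ₄`-linear if it is the Gray image of a quaternary linear code. -/
def IsZ4Linear {N : ℕ} (B : Set (Fin (N * 2) → ZMod 2)) : Prop :=
  ∃ C : AddSubgroup (Fin N → ZMod 4), B = grayImage C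

/-! ### Hadamard codes and extended perfect codes -/

/-- A binary code of length `n` is a Hadamard code if it consists of the rows of a Hadamard matrix
of order `n` and of their negatives, where an entry `1` is written `0` and `-1` is written `1`. -/
def IsHadamardCode {n : ℕ} (C : Set (Fin n → ZMod 2)) : Prop :=
  ∃ H : Matrix (Fin n) (Fin n) ℤ, H.IsHadamard ∧
    C = {x | ∃ i, (∀ j, x j = 0 ↔ H i j = 1) ∨ (∀ j, x j = 0 ↔ H i j = -1)}

/-- A perfect single-error-correcting binary code: the balls of radius 1 around the codewords
partition the space. -/
def IsPerfectCode {ι : Type*} [Fintype ι] (D : Set (ι → ZMod 2)) : Prop :=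
  ∀ x : ι → ZMod 2, ∃! c, c ∈ D ∧ hammingDist x c ≤ 1

/-- An extended perfect code: it arises from a perfect code by the addition of one overall parity
check coordinate (in some position `p`). -/
def IsExtendedPerfectCode {n : ℕ} (C : Set (Fin n → ZMod 2)) : Prop :=
  ∃ (p : Fin n) (D : Set ({i : Fin n // i ≠ p} → ZMod 2)), IsPerfectCode D ∧
    C = {x | (fun i : {i : Fin n // i ≠ p} => x i) ∈ D ∧ ∑ i, x i = 0}

/-! ### Kronecker inner product and duality -/

/-- `K_N` for `N = 2 ^ n`: the `n`-fold Kronecker power of `!![1, 0; 0, 3]`. -/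
def kroneckerK : (n : ℕ) → Matrix (Fin (2 ^ n)) (Fin (2 ^ n)) (ZMod 4)
  | 0 => 1
  | n + 1 =>
    let e : Fin 2 × Fin (2 ^ n) ≃ Fin (2 ^ (n + 1)) :=
      finProdFinEquiv.trans (finCongr (pow_succ' 2 n).symm)
    Matrix.reindex e e (Matrix.kroneckerMap (· * ·) !![1, 0; 0, 3] (kroneckerK n))

/-- The Kronecker inner product `u K_N vᵗ`. -/
def kroneckerInner {n : ℕ} (u v : Fin (2 ^ n) → ZMod 4) : ZMod 4 :=
  u ⬝ᵥ (Matrix.mulVec (kroneckerK n) v)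

/-- The quaternary dual code with respect to the Kronecker inner product. -/
def kroneckerDual {n : ℕ} (C : AddSubgroup (Fin (2 ^ n) → ZMod 4)) :
    AddSubgroup (Fin (2 ^ n) → ZMod 4) where
  carrier := {u | ∀ v ∈ C, kroneckerInner u v = 0}
  zero_mem' := by
    intro v _
    simp [kroneckerInner]
  add_mem' := by
    intro a b ha hb v hv
    have h1 := ha v hv
    have h2 := hb v hv
    simp only [kroneckerInner] at h1 h2 ⊢
    rw [add_dotProduct, h1, h2, add_zero]
  neg_mem' := by
    intro a ha v hv
    have h1 := ha v hv
    simp only [kroneckerInner] at h1 ⊢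
    rw [neg_dotProduct, h1, neg_zero]

/-! ### Generator matrices and the Plotkin constructions -/

/-- A generator matrix of a quaternary linear code of length `N`, given by its list `two` of rows
of order two (entries `0` and `2`) and its list `four` of rows of order four. -/
structure GenMatrix (N : ℕ) where
  two : List (Fin N → ZMod 4)
  four : List (Fin N → ZMod 4)

/-- The quaternary linear code generated by the rows of `G`. -/
def GenMatrix.code {N : ℕ} (G : GenMatrix N) : AddSubgroup (Fin N → ZMod 4) :=
  AddSubgroup.closure {u | u ∈ G.two ++ G.four}

/-- Rows of the matrix `G'`: in the rows of order two every `2` is replaced by `1`. -/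
def GenMatrix.primeRows {N : ℕ} (G : GenMatrix N) : List (Fin N → ZMod 4) :=
  G.two.map (fun u i => if u i = 2 then 1 else u i) ++ G.four

/-- Rows of the matrix `Ĝ`: the rows of order two are removed. -/
def GenMatrix.hatRows {N : ℕ} (G : GenMatrix N) : List (Fin N → ZMod 4) := G.four

/-- The concatenation `(u | v)`. -/
def cat {n : ℕ} (u v : Fin (2 ^ n) → ZMod 4) : Fin (2 ^ (n + 1)) → ZMod 4 :=
  fun i => if h : i.val < 2 ^ n then u ⟨i.val, h⟩
    else v ⟨i.val - 2 ^ n, by have := i.isLt; have := pow_succ 2 n; omega⟩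

/-- The concatenation `(a | b | c | d)`. -/
def cat4 {n : ℕ} (a b c d : Fin (2 ^ n) → ZMod 4) : Fin (2 ^ (n + 2)) → ZMod 4 :=
  cat (cat a b) (cat c d)

/-- The Plotkin construction: the generator matrix with block rows `(A | A)`, `(0 | B)` of the code
`{(u | u + v) : u ∈ 𝒜, v ∈ ℬ}`. -/
def plotkin {n : ℕ} (A B : GenMatrix (2 ^ n)) : GenMatrix (2 ^ (n + 1)) where
  two := A.two.map (fun u => cat u u) ++ B.two.map (fun u => cat 0 u)
  four := A.four.map (fun u => cat u u) ++ B.four.map (fun u => cat 0 u)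

/-- The BQ-Plotkin construction: the generator matrix with block rows `(A | A | A | A)`,
`(0 | B' | 2B' | 3B')`, `(0 | 0 | B̂ | B̂)` and `(0 | 0 | 0 | C)`. -/
def bqPlotkin {n : ℕ} (A B C : GenMatrix (2 ^ n)) : GenMatrix (2 ^ (n + 2)) where
  two := A.two.map (fun u => cat4 u u u u) ++ C.two.map (fun u => cat4 0 0 0 u)
  four := A.four.map (fun u => cat4 u u u u) ++
    B.primeRows.map (fun u => cat4 0 u (2 • u) (3 • u)) ++
    B.hatRows.map (fun u => cat4 0 0 u u) ++
    C.four.map (fun u => cat4 0 0 0 u)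

/-! ### The quaternary Reed-Muller codes -/

/-- The generator matrices of the extreme orders, for vectors of length `N = 2 ^ (m - 1)`: the zero
code for `r < 0`, the single row `(2 ⋯ 2)` for `r = 0`, the identity matrix for `r ≥ m`. For the
remaining orders the matrix `G` is used. -/
def withExtremes {N : ℕ} (m : ℕ) (r : ℤ) (G : GenMatrix N) : GenMatrix N :=
  if r < 0 then ⟨[], []⟩
  else if r = 0 then ⟨[fun _ => 2], []⟩
  else if (m : ℤ) ≤ r then ⟨[], List.ofFn (fun i : Fin N => Pi.single i 1)⟩
  else G

/-- `genRM n s r` is the generator matrix of the code `RM_s(r, m)` with `m = n + 1`, of quaternary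
length `2 ^ n`. For `m = 1` there are only extreme orders. For `m` odd and `s = (m - 1) / 2`,
`0 < r < m`, it comes from the family `s - 1` for `m - 2` by the BQ-Plotkin construction (for
`r = m - 1` the first two ingredients are both the whole space); otherwise it comes from the family
`s` for `m - 1` by the Plotkin construction. -/
def genRM : (n : ℕ) → (s : ℕ) → (r : ℤ) → GenMatrix (2 ^ n)
  | 0, _, r => withExtremes 1 r ⟨[], []⟩
  | 1, s, r => withExtremes 2 r (plotkin (genRM 0 s r) (genRM 0 s (r - 1)))
  | n + 2, s, r => withExtremes (n + 3) r <|
      if 2 * s = n + 2 then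
        bqPlotkin (genRM n (s - 1) r) (genRM n (s - 1) (r - 1)) (genRM n (s - 1) (r - 2))
      else plotkin (genRM (n + 1) s r) (genRM (n + 1) s (r - 1))

/-- The quaternary linear Reed-Muller code `RM_s(r, m)`, for `m ≥ 1` and `0 ≤ s ≤ ⌊(m - 1) / 2⌋`. -/
def RM (s : ℕ) (r : ℤ) (m : ℕ) : AddSubgroup (Fin (2 ^ (m - 1)) → ZMod 4) :=
  (genRM (m - 1) s r).code

end Z4RM

open Z4RM

/-!
Each generator matrix `G` of the Reed-Muller codes generates three codes: `H`, generated by the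
rows of order four; `C`, generated by all rows; and `P`, generated by all rows after the rows of
order two have been halved. The theorem is proved for all three layers at once, because the
BQ-Plotkin construction uses the layers `P` and `H` of its second ingredient.

On the level of subgroups the two constructions are the shears `{(a | a + b)}` and
`{(a | a + b | a + 2b + c | a + 3b + c + d)}` (`plotkinSum`, `bqSum`), and the layers
`X ∈ {H, C, P}` satisfy the recursions

* `X(r, m) = {(a | a + b) : a ∈ X(r, m - 1), b ∈ X(r - 1, m - 1)}`,
* `X(r, m) = {(a | a + b | a + 2b + c | a + 3b + c + d)}` with `a ∈ X(r, m - 2)`,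
  `b ∈ P(r - 1, m - 2)`, `c ∈ H(r - 1, m - 2)`, `d ∈ X(r - 2, m - 2)`.

The extreme orders need no separate treatment (`layer_genRM`), and everything follows by induction
(`family_induction`):

* inclusions: `P(r - 1) ⊆ H(r) ⊆ C(r) ⊆ P(r)` (`family_chain`);
* cardinality: `|P(r)| |H(r)| = |C(r)| ^ 2`, hence `log₂ |C(r, m)|` satisfies the recursion of the
  partial sums of binomial coefficients
  (`card_code_and_card_prime_mul_card_hat`);
* minimum weight: `d`, `2b + c` and `b` are signed sums of the four blocks, so a nonzero one of them
  bounds the weight from below (`le_leeWeight_of_mem_family`). For `b ∈ P` this suffices because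
  `b` matters only if `d = 2b + c = 0`, and then `2b ∈ H` forces `b ∈ C` (`mem_code_of_two_nsmul`);
* duality: the Gram matrices of the two shears for the Kronecker form are anti-triangular, so the
  dual of a shear is the shear of the duals in reverse order. It exchanges `P` and `H` and fixes
  `C` (`family_eq_kroneckerDual`).

The code of order `m - 1` is the dual of `{0, (2 ⋯ 2)}`, which gives the even weight vectors. The
codes of order `1` and `m - 2` are recognized by their parameters: a self-complementary binary code
with `2 n` codewords of length `n` at mutual distances `0`, `n / 2`, `n` is a Hadamard code, and an
even code of minimum distance `4` that meets the sphere packing bound after puncturing is an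
extended perfect code. The Gray map is an isometry and transfers the parameters.
-/

open Z4RM

namespace Z4RM

/-! ### Concatenation, Lee weight and the Kronecker form -/

/-- Quaternary vectors of length `2 ^ n`. -/
abbrev Vec (n : ℕ) := Fin (2 ^ n) → ZMod 4

/-- The positions of `Fin (2 ^ (n + 1))` as pairs (half, position in this half), as in the
definition of `kroneckerK`. -/
def halves (n : ℕ) : Fin 2 × Fin (2 ^ n) ≃ Fin (2 ^ (n + 1)) :=
  finProdFinEquiv.trans (finCongr (pow_succ' 2 n).symm)

@[simp] theorem cat_halves_zero {n : ℕ} (u v : Vec n) (b : Fin (2 ^ n)) :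
    cat u v (halves n (0, b)) = u b := by
  simp [cat, halves]

@[simp] theorem cat_halves_one {n : ℕ} (u v : Vec n) (b : Fin (2 ^ n)) :
    cat u v (halves n (1, b)) = v b := by
  simp [cat, halves]

theorem sum_halves {n : ℕ} {M : Type*} [AddCommMonoid M] (f : Fin (2 ^ (n + 1)) → M) :
    ∑ i, f i = ∑ b, f (halves n (0, b)) + ∑ b, f (halves n (1, b)) := by
  rw [← (halves n).sum_comp, Fintype.sum_prod_type, Fin.sum_univ_two]

theorem forall_halves {n : ℕ} {p : Fin (2 ^ (n + 1)) → Prop} :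
    (∀ i, p i) ↔ (∀ b, p (halves n (0, b))) ∧ ∀ b, p (halves n (1, b)) := by
  rw [← (halves n).forall_congr_right, Prod.forall, Fin.forall_fin_two]

theorem exists_eq_cat {n : ℕ} (w : Vec (n + 1)) : ∃ u v, w = cat u v :=
  ⟨fun b => w (halves n (0, b)), fun b => w (halves n (1, b)),
    funext (forall_halves.2 ⟨fun b => by simp, fun b => by simp⟩)⟩

@[simp] theorem cat_inj {n : ℕ} {u v u' v' : Vec n} : cat u v = cat u' v' ↔ u = u' ∧ v = v' := by
  rw [funext_iff, forall_halves, funext_iff, funext_iff]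
  simp

theorem cat_add {n : ℕ} (u v u' v' : Vec n) :
    cat u v + cat u' v' = cat (u + u') (v + v') :=
  funext (forall_halves.2 ⟨fun b => by simp, fun b => by simp⟩)

theorem cat_const {n : ℕ} (x : ZMod 4) :
    cat (fun _ : Fin (2 ^ n) => x) (fun _ => x) = fun _ => x :=
  funext (forall_halves.2 ⟨fun b => by simp, fun b => by simp⟩)

@[simp] theorem cat_zero_zero {n : ℕ} : cat (0 : Vec n) 0 = 0 := cat_const 0

@[simp] theorem leeWeight_cat {n : ℕ} (u v : Vec n) :
    leeWeight (cat u v) = leeWeight u + leeWeight v := by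
  simp [leeWeight, sum_halves]

@[simp] theorem leeWeight_zero {N : ℕ} : leeWeight (0 : Fin N → ZMod 4) = 0 := by
  simp [leeWeight, leeWt]

theorem leeWeight_neg {N : ℕ} (u : Fin N → ZMod 4) : leeWeight (-u) = leeWeight u :=
  Finset.sum_congr rfl fun i _ => (by decide : ∀ x : ZMod 4, leeWt (-x) = leeWt x) (u i)

theorem leeWeight_add_le {N : ℕ} (u v : Fin N → ZMod 4) :
    leeWeight (u + v) ≤ leeWeight u + leeWeight v := by
  rw [leeWeight, leeWeight, leeWeight, ← Finset.sum_add_distrib]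
  exact Finset.sum_le_sum fun i _ =>
    (by decide : ∀ x y : ZMod 4, leeWt (x + y) ≤ leeWt x + leeWt y) (u i) (v i)

theorem leeWeight_sub_le {N : ℕ} (u v : Fin N → ZMod 4) :
    leeWeight (u - v) ≤ leeWeight u + leeWeight v := by
  simpa [sub_eq_add_neg, leeWeight_neg] using leeWeight_add_le u (-v)

theorem leeWeight_pos {N : ℕ} {u : Fin N → ZMod 4} (hu : u ≠ 0) : 0 < leeWeight u := by
  obtain ⟨i, hi⟩ := Function.ne_iff.1 hu
  refine lt_of_lt_of_le ?_ (Finset.single_le_sum (fun _ _ => Nat.zero_le _) (Finset.mem_univ i))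
  exact (by decide : ∀ x : ZMod 4, x ≠ 0 → 0 < leeWt x) (u i) hi

theorem leeWeight_add_two {N : ℕ} (u : Fin N → ZMod 4) :
    leeWeight (u + fun _ => 2) + leeWeight u = N * 2 := by
  rw [leeWeight, leeWeight, ← Finset.sum_add_distrib]
  refine (Finset.sum_congr rfl fun i _ =>
    (by decide : ∀ x : ZMod 4, leeWt (x + 2) + leeWt x = 2) (u i)).trans ?_
  simp

theorem kroneckerInner_cat {n : ℕ} (u v u' v' : Vec n) :
    kroneckerInner (cat u v) (cat u' v') = kroneckerInner u u' - kroneckerInner v v' := by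
  have hK (a b : Fin 2) (i j : Fin (2 ^ n)) :
      kroneckerK (n + 1) (halves n (a, i)) (halves n (b, j)) =
        (!![1, 0; 0, 3] : Matrix (Fin 2) (Fin 2) (ZMod 4)) a b * kroneckerK n i j := by
    rw [kroneckerK]
    change Matrix.reindex (halves n) (halves n) _ _ _ = _
    simp
  simp only [kroneckerInner, dotProduct, Matrix.mulVec, sum_halves, hK, cat_halves_zero,
    cat_halves_one]
  have h3 : (3 : ZMod 4) = -1 := by decide
  simp [h3, sub_eq_add_neg]

theorem kroneckerInner_add_left {n : ℕ} (u v w : Vec n) :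
    kroneckerInner (u + v) w = kroneckerInner u w + kroneckerInner v w := by
  simp [kroneckerInner, add_dotProduct]

theorem kroneckerInner_add_right {n : ℕ} (u v w : Vec n) :
    kroneckerInner u (v + w) = kroneckerInner u v + kroneckerInner u w := by
  simp [kroneckerInner, Matrix.mulVec_add]

@[simp] theorem kroneckerInner_zero_right {n : ℕ} (u : Vec n) : kroneckerInner u 0 = 0 := by
  simp [kroneckerInner]

@[simp] theorem kroneckerInner_zero_left {n : ℕ} (u : Vec n) : kroneckerInner 0 u = 0 := by
  simp [kroneckerInner]

theorem mem_kroneckerDual {n : ℕ} {C : AddSubgroup (Vec n)} {u : Vec n} :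
    u ∈ kroneckerDual C ↔ ∀ v ∈ C, kroneckerInner u v = 0 := Iff.rfl

/-- The signs in the Kronecker form do not matter against the all-twos vector, because `3 * 2 = 2`
in `ZMod 4`. -/
theorem kroneckerInner_two {n : ℕ} (u : Vec n) :
    kroneckerInner u (fun _ => 2) = 2 * (leeWeight u : ZMod 4) := by
  induction n with
  | zero =>
    simp only [kroneckerInner, kroneckerK, leeWeight, Matrix.one_mulVec, dotProduct]
    rw [Nat.cast_sum, Finset.mul_sum]
    exact Finset.sum_congr rfl fun i _ =>
      (by decide : ∀ x : ZMod 4, x * 2 = 2 * (leeWt x : ZMod 4)) (u i)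
  | succ n ih =>
    obtain ⟨v, w, rfl⟩ := exists_eq_cat u
    rw [← cat_const, kroneckerInner_cat, ih, ih, leeWeight_cat, Nat.cast_add]
    generalize (leeWeight v : ZMod 4) = x
    generalize (leeWeight w : ZMod 4) = y
    revert x y
    decide

/-! ### The two Plotkin sums of subgroups -/

/-- The shear `(a, b) ↦ (a | a + b)`. -/
def plotkinHom (n : ℕ) : Vec n × Vec n →+ Vec (n + 1) where
  toFun p := cat p.1 (p.1 + p.2)
  map_zero' := by simp
  map_add' p q := by rw [cat_add, Prod.fst_add, Prod.snd_add, add_add_add_comm]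

/-- The shear `(a, b, c, d) ↦ (a | a + b | a + 2b + c | a + 3b + c + d)`. -/
def bqHom (n : ℕ) : Vec n × Vec n × Vec n × Vec n →+ Vec (n + 2) where
  toFun p := cat4 p.1 (p.1 + p.2.1) (p.1 + 2 • p.2.1 + p.2.2.1)
    (p.1 + 3 • p.2.1 + p.2.2.1 + p.2.2.2)
  map_zero' := by simp [cat4]
  map_add' p q := by
    simp only [cat4, cat_add, cat_inj, Prod.fst_add, Prod.snd_add]
    refine ⟨⟨trivial, ?_⟩, ?_, ?_⟩ <;> abel

theorem plotkinHom_injective (n : ℕ) : Function.Injective (plotkinHom n) := by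
  rintro ⟨a, b⟩ ⟨a', b'⟩ h
  obtain ⟨rfl, h⟩ := cat_inj.1 h
  simpa using h

theorem plotkinHom_surjective (n : ℕ) : Function.Surjective (plotkinHom n) := fun w => by
  obtain ⟨u, v, rfl⟩ := exists_eq_cat w
  exact ⟨(u, v - u), by simp [plotkinHom]⟩

theorem bqHom_injective (n : ℕ) : Function.Injective (bqHom n) := by
  rintro ⟨a, b, c, d⟩ ⟨a', b', c', d'⟩ h
  obtain ⟨h1, h2⟩ := cat_inj.1 h
  obtain ⟨rfl, h1⟩ := cat_inj.1 h1
  obtain rfl : b = b' := by simpa using h1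
  obtain ⟨h2, h3⟩ := cat_inj.1 h2
  obtain rfl : c = c' := by simpa using h2
  simpa using h3

theorem bqHom_surjective (n : ℕ) : Function.Surjective (bqHom n) := fun w => by
  obtain ⟨u, v, rfl⟩ := exists_eq_cat w
  obtain ⟨x, y, rfl⟩ := exists_eq_cat u
  obtain ⟨z, t, rfl⟩ := exists_eq_cat v
  refine ⟨(x, y - x, z - x - 2 • (y - x), t - y - z + x), ?_⟩
  simp only [bqHom, AddMonoidHom.coe_mk, ZeroHom.coe_mk, cat4, cat_inj]
  refine ⟨⟨trivial, ?_⟩, ?_, ?_⟩ <;> abel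

/-- The code `{(a | a + b) : a ∈ A, b ∈ B}`. -/
def plotkinSum {n : ℕ} (A B : AddSubgroup (Vec n)) : AddSubgroup (Vec (n + 1)) :=
  (A.prod B).map (plotkinHom n)

/-- The code `{(a | a + b | a + 2b + c | a + 3b + c + d) : a ∈ A, b ∈ B, c ∈ C, d ∈ D}`. -/
def bqSum {n : ℕ} (A B C D : AddSubgroup (Vec n)) : AddSubgroup (Vec (n + 2)) :=
  (A.prod (B.prod (C.prod D))).map (bqHom n)

theorem mem_plotkinSum {n : ℕ} {A B : AddSubgroup (Vec n)} {p : Vec n × Vec n} :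
    plotkinHom n p ∈ plotkinSum A B ↔ p.1 ∈ A ∧ p.2 ∈ B := by
  rw [plotkinSum, AddSubgroup.mem_map_iff_mem (plotkinHom_injective n), AddSubgroup.mem_prod]

theorem mem_bqSum {n : ℕ} {A B C D : AddSubgroup (Vec n)} {p : Vec n × Vec n × Vec n × Vec n} :
    bqHom n p ∈ bqSum A B C D ↔ p.1 ∈ A ∧ p.2.1 ∈ B ∧ p.2.2.1 ∈ C ∧ p.2.2.2 ∈ D := by
  rw [bqSum, AddSubgroup.mem_map_iff_mem (bqHom_injective n)]
  simp only [AddSubgroup.mem_prod]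

theorem plotkinHom_mem {n : ℕ} {A B : AddSubgroup (Vec n)} {a b : Vec n} (ha : a ∈ A)
    (hb : b ∈ B) : plotkinHom n (a, b) ∈ plotkinSum A B :=
  mem_plotkinSum.2 ⟨ha, hb⟩

theorem bqHom_mem {n : ℕ} {A B C D : AddSubgroup (Vec n)} {a b c d : Vec n} (ha : a ∈ A)
    (hb : b ∈ B) (hc : c ∈ C) (hd : d ∈ D) : bqHom n (a, b, c, d) ∈ bqSum A B C D :=
  mem_bqSum.2 ⟨ha, hb, hc, hd⟩

theorem plotkinSum_mono {n : ℕ} {A B A' B' : AddSubgroup (Vec n)} (hA : A ≤ A') (hB : B ≤ B') :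
    plotkinSum A B ≤ plotkinSum A' B' :=
  AddSubgroup.map_mono (AddSubgroup.prod_mono hA hB)

theorem bqSum_mono {n : ℕ} {A B C D A' B' C' D' : AddSubgroup (Vec n)} (hA : A ≤ A')
    (hB : B ≤ B') (hC : C ≤ C') (hD : D ≤ D') : bqSum A B C D ≤ bqSum A' B' C' D' :=
  AddSubgroup.map_mono
    (AddSubgroup.prod_mono hA (AddSubgroup.prod_mono hB (AddSubgroup.prod_mono hC hD)))

theorem plotkinSum_bot {n : ℕ} : plotkinSum (⊥ : AddSubgroup (Vec n)) ⊥ = ⊥ := by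
  simp [plotkinSum]

theorem plotkinSum_top {n : ℕ} : plotkinSum (⊤ : AddSubgroup (Vec n)) ⊤ = ⊤ := by
  rw [plotkinSum, AddSubgroup.top_prod_top,
    AddSubgroup.map_top_of_surjective _ (plotkinHom_surjective n)]

theorem bqSum_bot {n : ℕ} : bqSum (⊥ : AddSubgroup (Vec n)) ⊥ ⊥ ⊥ = ⊥ := by
  simp [bqSum]

theorem bqSum_top {n : ℕ} : bqSum (⊤ : AddSubgroup (Vec n)) ⊤ ⊤ ⊤ = ⊤ := by
  rw [bqSum, AddSubgroup.top_prod_top, AddSubgroup.top_prod_top, AddSubgroup.top_prod_top,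
    AddSubgroup.map_top_of_surjective _ (bqHom_surjective n)]

theorem card_plotkinSum {n : ℕ} (A B : AddSubgroup (Vec n)) :
    Nat.card (plotkinSum A B) = Nat.card A * Nat.card B := by
  rw [plotkinSum, ← Nat.card_congr ((A.prod B).equivMapOfInjective _
    (plotkinHom_injective n)).toEquiv, Nat.card_congr (AddSubgroup.prodEquiv A B).toEquiv,
    Nat.card_prod]

theorem card_bqSum {n : ℕ} (A B C D : AddSubgroup (Vec n)) :
    Nat.card (bqSum A B C D) = Nat.card A * (Nat.card B * (Nat.card C * Nat.card D)) := by
  rw [bqSum, ← Nat.card_congr (AddSubgroup.equivMapOfInjective _ _ (bqHom_injective n)).toEquiv,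
    Nat.card_congr (AddSubgroup.prodEquiv _ _).toEquiv, Nat.card_prod,
    Nat.card_congr (AddSubgroup.prodEquiv _ _).toEquiv, Nat.card_prod,
    Nat.card_congr (AddSubgroup.prodEquiv _ _).toEquiv, Nat.card_prod]

theorem closure_plotkin {n : ℕ} (S T : Set (Vec n)) :
    AddSubgroup.closure ((fun u => cat u u) '' S ∪ (fun u => cat 0 u) '' T) =
      plotkinSum (AddSubgroup.closure S) (AddSubgroup.closure T) := by
  apply le_antisymm
  · rw [AddSubgroup.closure_le]
    rintro _ (⟨u, hu, rfl⟩ | ⟨u, hu, rfl⟩)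
    · exact ⟨(u, 0), ⟨AddSubgroup.subset_closure hu, zero_mem _⟩, by simp [plotkinHom]⟩
    · exact ⟨(0, u), ⟨zero_mem _, AddSubgroup.subset_closure hu⟩, by simp [plotkinHom]⟩
  · simp only [plotkinSum, AddSubgroup.map_le_iff_le_comap, AddSubgroup.prod_le_iff,
      AddSubgroup.closure_le]
    constructor
    · intro u hu
      exact AddSubgroup.subset_closure (Or.inl ⟨u, hu, by simp [plotkinHom]⟩)
    · intro u hu
      exact AddSubgroup.subset_closure (Or.inr ⟨u, hu, by simp [plotkinHom]⟩)

theorem closure_bq {n : ℕ} (S T U V : Set (Vec n)) :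
    AddSubgroup.closure ((fun u => cat4 u u u u) '' S ∪ (fun u => cat4 0 u (2 • u) (3 • u)) '' T ∪
        (fun u => cat4 0 0 u u) '' U ∪ (fun u => cat4 0 0 0 u) '' V) =
      bqSum (AddSubgroup.closure S) (AddSubgroup.closure T) (AddSubgroup.closure U)
        (AddSubgroup.closure V) := by
  apply le_antisymm
  · rw [AddSubgroup.closure_le]
    rintro _ (((⟨u, hu, rfl⟩ | ⟨u, hu, rfl⟩) | ⟨u, hu, rfl⟩) | ⟨u, hu, rfl⟩)
    · exact ⟨(u, 0, 0, 0), ⟨AddSubgroup.subset_closure hu, zero_mem _, zero_mem _, zero_mem _⟩,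
        by simp [bqHom]⟩
    · exact ⟨(0, u, 0, 0), ⟨zero_mem _, AddSubgroup.subset_closure hu, zero_mem _, zero_mem _⟩,
        by simp [bqHom]⟩
    · exact ⟨(0, 0, u, 0), ⟨zero_mem _, zero_mem _, AddSubgroup.subset_closure hu, zero_mem _⟩,
        by simp [bqHom]⟩
    · exact ⟨(0, 0, 0, u), ⟨zero_mem _, zero_mem _, zero_mem _, AddSubgroup.subset_closure hu⟩,
        by simp [bqHom]⟩
  · simp only [bqSum, AddSubgroup.map_le_iff_le_comap, AddSubgroup.prod_le_iff,
      AddSubgroup.closure_le]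
    refine ⟨fun u hu => ?_, fun u hu => ?_, fun u hu => ?_, fun u hu => ?_⟩
    · exact AddSubgroup.subset_closure (Or.inl (Or.inl (Or.inl ⟨u, hu, by simp [bqHom]⟩)))
    · exact AddSubgroup.subset_closure (Or.inl (Or.inl (Or.inr ⟨u, hu, by simp [bqHom]⟩)))
    · exact AddSubgroup.subset_closure (Or.inl (Or.inr ⟨u, hu, by simp [bqHom]⟩))
    · exact AddSubgroup.subset_closure (Or.inr ⟨u, hu, by simp [bqHom]⟩)

theorem kroneckerInner_plotkinHom {n : ℕ} (a b a' b' : Vec n) :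
    kroneckerInner (plotkinHom n (a, b)) (plotkinHom n (a', b')) =
      -(kroneckerInner a b' + kroneckerInner b a' + kroneckerInner b b') := by
  simp only [plotkinHom, AddMonoidHom.coe_mk, ZeroHom.coe_mk, kroneckerInner_cat,
    kroneckerInner_add_left, kroneckerInner_add_right]
  ring

/-- The Gram matrix of the vectors `1 1 1 1`, `0 1 2 3`, `0 0 1 1`, `0 0 0 1` for the Kronecker
form is anti-triangular with units on the antidiagonal. -/
theorem kroneckerInner_bqHom {n : ℕ} (a b c d a' b' c' d' : Vec n) :
    kroneckerInner (bqHom n (a, b, c, d)) (bqHom n (a', b', c', d')) =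
      kroneckerInner a d' + kroneckerInner d a' + kroneckerInner b c' + kroneckerInner c b' +
        3 * kroneckerInner b d' + 3 * kroneckerInner d b' + kroneckerInner c d' +
        kroneckerInner d c' + kroneckerInner d d' := by
  have h4 : (4 : ZMod 4) = 0 := by decide
  simp only [bqHom, AddMonoidHom.coe_mk, ZeroHom.coe_mk, cat4, kroneckerInner_cat,
    succ_nsmul, zero_nsmul, zero_add,
    kroneckerInner_add_left, kroneckerInner_add_right]
  linear_combination kroneckerInner b b' * h4

/-! ### The three layers of the Reed-Muller codes -/

/-- The rows of a generator matrix generate three codes: `hat` is generated by the rows of order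
four, `code` by all rows, and `prime` by all rows after the rows of order two have been halved. -/
inductive Layer
  | hat
  | code
  | prime

/-- The layer of the Kronecker dual. -/
def Layer.dual : Layer → Layer
  | hat => prime
  | code => code
  | prime => hat

/-- The constant entry of the generator of order `0` in the given layer. -/
def Layer.unit : Layer → ZMod 4
  | hat => 0
  | code => 2
  | prime => 1

/-- A family of quaternary codes of length `2 ^ n`, indexed by a layer and an order. -/
abbrev Family (n : ℕ) := Layer → ℤ → AddSubgroup (Vec n)

/-- The family of length `1`. -/
def baseFamily : Family 0 := fun t r =>
  if 1 ≤ r then ⊤ else if r = 0 then AddSubgroup.zmultiples (fun _ => t.unit) else ⊥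

/-- The Plotkin construction on all layers and orders. -/
def plotkinFamily {n : ℕ} (F : Family n) : Family (n + 1) := fun t r =>
  plotkinSum (F t r) (F t (r - 1))

/-- The BQ-Plotkin construction on all layers and orders. The two middle rows have order four, so
they contribute to all layers in the same way. -/
def bqFamily {n : ℕ} (F : Family n) : Family (n + 2) := fun t r =>
  bqSum (F t r) (F .prime (r - 1)) (F .hat (r - 1)) (F t (r - 2))

/-- The layers of `RM_s(r, n + 1)`, obtained from the two constructions without special treatment
of the extreme orders. -/
def family : (n s : ℕ) → Family n
  | 0, _ => baseFamily
  | 1, s => plotkinFamily (family 0 s)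
  | n + 2, s =>
    if 2 * s = n + 2 then bqFamily (family n (s - 1)) else plotkinFamily (family (n + 1) s)

/-- A property of families holds for all `family n s` if it holds in length `1` and is preserved by
both constructions. Since the steps concern members of `family` only, facts proved earlier are
available in them. -/
theorem family_induction {p : ∀ n, Family n → Prop} (base : p 0 baseFamily)
    (plotkin : ∀ n s, p n (family n s) → p (n + 1) (plotkinFamily (family n s)))
    (bq : ∀ n s, p n (family n s) → p (n + 2) (bqFamily (family n s))) : ∀ n s, p n (family n s)
  | 0, _ => base
  | 1, s => plotkin 0 0 base
  | n + 2, s => by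
    rw [family]
    split_ifs
    · exact bq _ _ (family_induction base plotkin bq _ _)
    · exact plotkin _ _ (family_induction base plotkin bq _ _)

/-! ### Extreme orders and inclusions -/

theorem family_of_neg (n s : ℕ) : ∀ t r, r < 0 → family n s t r = ⊥ := by
  refine family_induction (p := fun n F => ∀ t r, r < 0 → F t r = ⊥) ?_ ?_ ?_ n s
  · intro t r hr
    rw [baseFamily, if_neg (by omega), if_neg (by omega)]
  · intro n s ih t r hr
    rw [plotkinFamily, ih _ _ hr, ih _ _ (by omega), plotkinSum_bot]
  · intro n s ih t r hr
    rw [bqFamily, ih _ _ hr, ih _ _ (by omega), ih _ _ (by omega), ih _ _ (by omega), bqSum_bot]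

theorem family_of_lt (n s : ℕ) : ∀ t (r : ℤ), n < r → family n s t r = ⊤ := by
  refine family_induction (p := fun n F => ∀ t (r : ℤ), n < r → F t r = ⊤) ?_ ?_ ?_ n s
  · intro t r hr
    rw [baseFamily, if_pos (by omega)]
  · intro n s ih t r hr
    rw [plotkinFamily, ih _ _ (by omega), ih _ _ (by omega), plotkinSum_top]
  · intro n s ih t r hr
    rw [bqFamily, ih _ _ (by omega), ih _ _ (by omega), ih _ _ (by omega), ih _ _ (by omega),
      bqSum_top]

theorem family_zero (n s : ℕ) :
    ∀ t, family n s t 0 = AddSubgroup.zmultiples (fun _ => t.unit) := by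
  refine family_induction
    (p := fun n F => ∀ t, F t 0 = AddSubgroup.zmultiples (fun _ => t.unit)) ?_ ?_ ?_ n s
  · intro t
    rw [baseFamily, if_neg (by omega), if_pos rfl]
  · intro n s ih t
    rw [plotkinFamily, ih, family_of_neg _ _ _ _ (by omega), AddSubgroup.zmultiples_eq_closure,
      ← AddSubgroup.closure_empty, ← closure_plotkin]
    simp [cat_const, AddSubgroup.zmultiples_eq_closure]
  · intro n s ih t
    rw [bqFamily, ih, family_of_neg _ _ _ _ (by omega), family_of_neg _ _ _ _ (by omega),
      family_of_neg _ _ _ _ (by omega), AddSubgroup.zmultiples_eq_closure,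
      ← AddSubgroup.closure_empty, ← closure_bq]
    simp [cat4, cat_const, AddSubgroup.zmultiples_eq_closure]

theorem vec_zero_ext {u v : Vec 0} (h : u 0 = v 0) : u = v :=
  funext fun i => by rwa [Subsingleton.elim (α := Fin 1) i 0]

theorem baseFamily_prime (r : ℤ) : baseFamily .prime r = if 0 ≤ r then ⊤ else ⊥ := by
  have h : AddSubgroup.zmultiples (fun _ => 1 : Vec 0) = ⊤ := by
    refine eq_top_iff.2 fun u _ => AddSubgroup.mem_zmultiples_iff.2 ⟨(u 0).val, vec_zero_ext ?_⟩
    simp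
  rw [baseFamily, Layer.unit, h]
  split_ifs <;> first | rfl | omega

theorem baseFamily_hat (r : ℤ) : baseFamily .hat r = if 1 ≤ r then ⊤ else ⊥ := by
  rw [baseFamily, Layer.unit]
  have h : AddSubgroup.zmultiples (fun _ => 0 : Vec 0) = ⊥ := AddSubgroup.zmultiples_zero_eq_bot
  rw [h, ite_self]

/-- The inclusions between the layers: each layer of order `r` contains all layers of order
`r - 1`, and halving rows or adding rows of order two makes the code larger. -/
theorem family_chain (n s : ℕ) : ∀ r,
    family n s .prime (r - 1) ≤ family n s .hat r ∧ family n s .hat r ≤ family n s .code r ∧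
      family n s .code r ≤ family n s .prime r := by
  refine family_induction (p := fun n F => ∀ r, F .prime (r - 1) ≤ F .hat r ∧
    F .hat r ≤ F .code r ∧ F .code r ≤ F .prime r) ?_ ?_ ?_ n s
  · intro r
    simp only [baseFamily_hat, baseFamily_prime]
    rw [baseFamily]
    refine ⟨?_, ?_, ?_⟩
    · split_ifs <;> first | exact le_top | omega | exact bot_le
    · split_ifs <;> first | exact le_top | exact bot_le
    · split_ifs <;> first | exact le_top | omega | exact bot_le
  · intro n s ih r
    exact ⟨plotkinSum_mono (ih _).1 (ih _).1, plotkinSum_mono (ih _).2.1 (ih _).2.1,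
      plotkinSum_mono (ih _).2.2 (ih _).2.2⟩
  · intro n s ih r
    have h1 := (ih (r - 1)).1
    have h2 : family n s .prime (r - 1 - 1) ≤ family n s .prime (r - 1) :=
      h1.trans ((ih _).2.1.trans (ih _).2.2)
    have h3 : family n s .hat (r - 1 - 1) ≤ family n s .hat (r - 1) :=
      ((ih _).2.1.trans (ih _).2.2).trans h1
    have h4 : family n s .prime (r - 1 - 2) ≤ family n s .hat (r - 2) := by
      have := (ih (r - 2)).1
      rwa [sub_right_comm] at this
    exact ⟨bqSum_mono (ih _).1 h2 h3 h4, bqSum_mono (ih _).2.1 le_rfl le_rfl (ih _).2.1,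
      bqSum_mono (ih _).2.2 le_rfl le_rfl (ih _).2.2⟩

theorem two_nsmul_mem_family (n s : ℕ) : ∀ r, ∀ u ∈ family n s .prime r,
    2 • u ∈ family n s .code r := by
  refine family_induction (p := fun n F => ∀ r, ∀ u ∈ F .prime r, 2 • u ∈ F .code r) ?_ ?_ ?_ n s
  · intro r u hu
    rw [baseFamily_prime] at hu
    rw [baseFamily]
    split_ifs with h1 h2
    · trivial
    · refine AddSubgroup.mem_zmultiples_iff.2 ⟨(u 0).val, vec_zero_ext ?_⟩
      simp [Layer.unit, mul_comm]
    · rw [if_neg (by omega)] at hu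
      simp_all
  · intro n s ih r u hu
    obtain ⟨p, hp, rfl⟩ := hu
    rw [← map_nsmul]
    exact mem_plotkinSum.2 ⟨ih _ _ hp.1, ih _ _ hp.2⟩
  · intro n s ih r u hu
    obtain ⟨p, hp, rfl⟩ := hu
    rw [← map_nsmul]
    exact mem_bqSum.2 ⟨ih _ _ hp.1, AddSubgroup.nsmul_mem _ hp.2.1 _,
      AddSubgroup.nsmul_mem _ hp.2.2.1 _, ih _ _ hp.2.2.2⟩

/-- A vector of the layer `prime` is a combination of halved rows and rows of order four; if its
double lies in `hat`, then the halved rows occur with even coefficients. -/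
theorem mem_code_of_two_nsmul (n s : ℕ) : ∀ r, ∀ u ∈ family n s .prime r,
    2 • u ∈ family n s .hat r → u ∈ family n s .code r := by
  refine family_induction (p := fun n F => ∀ r, ∀ u ∈ F .prime r, 2 • u ∈ F .hat r →
    u ∈ F .code r) ?_ ?_ ?_ n s
  · intro r u hu h2
    rw [baseFamily_prime] at hu
    rw [baseFamily_hat] at h2
    rw [baseFamily]
    split_ifs with h1 h3
    · trivial
    · rw [if_neg h1] at h2
      have h4 : u 0 = 0 ∨ u 0 = 2 := (by decide : ∀ x : ZMod 4, 2 • x = 0 → x = 0 ∨ x = 2) _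
        (congrFun ((AddSubgroup.mem_bot).1 h2) 0)
      obtain h4 | h4 := h4
      · rw [vec_zero_ext (v := 0) h4]
        exact zero_mem _
      · rw [vec_zero_ext (v := fun _ => 2) h4]
        exact AddSubgroup.mem_zmultiples _
    · rwa [if_neg (by omega)] at hu
  · intro n s ih r u hu h2
    obtain ⟨p, hp, rfl⟩ := hu
    rw [← map_nsmul] at h2
    have h2 := mem_plotkinSum.1 h2
    exact mem_plotkinSum.2 ⟨ih _ _ hp.1 h2.1, ih _ _ hp.2 h2.2⟩
  · intro n s ih r u hu h2
    obtain ⟨p, hp, rfl⟩ := hu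
    rw [← map_nsmul] at h2
    have h2 := mem_bqSum.1 h2
    exact mem_bqSum.2 ⟨ih _ _ hp.1 h2.1, hp.2.1, hp.2.2.1, ih _ _ hp.2.2.2 h2.2.2.2⟩

/-! ### Number of codewords -/

/-- The sum of the binomial coefficients `m.choose i` over `0 ≤ i ≤ r`, for an integer `r`. -/
def binomSum (m : ℕ) (r : ℤ) : ℕ := ∑ i ∈ Finset.range (r + 1).toNat, m.choose i

theorem binomSum_of_neg (m : ℕ) {r : ℤ} (hr : r < 0) : binomSum m r = 0 := by
  rw [binomSum, Int.toNat_of_nonpos (by omega), Finset.sum_range_zero]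

theorem binomSum_natCast (m r : ℕ) : binomSum m r = ∑ i ∈ Finset.range (r + 1), m.choose i := rfl

theorem binomSum_succ (m : ℕ) (r : ℤ) :
    binomSum (m + 1) r = binomSum m r + binomSum m (r - 1) := by
  obtain hr | hr := lt_or_ge r 0
  · simp only [binomSum_of_neg _ hr, binomSum_of_neg _ (show r - 1 < 0 by omega)]
  · lift r to ℕ using hr
    rw [binomSum_natCast, binomSum_natCast, Finset.sum_range_succ', Finset.sum_range_succ' _ r,
      binomSum, sub_add_cancel, Int.toNat_natCast]
    simp only [Nat.choose_succ_succ, Finset.sum_add_distrib, Nat.choose_zero_right,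
      Nat.succ_eq_add_one]
    omega

theorem binomSum_add_two (m : ℕ) (r : ℤ) :
    binomSum (m + 2) r = binomSum m r + 2 * binomSum m (r - 1) + binomSum m (r - 2) := by
  rw [binomSum_succ, binomSum_succ, binomSum_succ, show r - 1 - 1 = r - 2 by omega]
  omega

theorem card_zmultiples_two : Nat.card (AddSubgroup.zmultiples (fun _ => 2 : Vec 0)) = 2 := by
  rw [Nat.card_zmultiples]
  refine addOrderOf_eq_prime (vec_zero_ext ?_) fun h => ?_
  · decide
  · exact absurd (congrFun h 0) (by decide)

/-- The second equation makes the contribution of the two middle blocks of the BQ-Plotkin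
construction computable: the layers `prime` and `hat` together have the size of two copies of
`code`. -/
theorem card_code_and_card_prime_mul_card_hat (n s : ℕ) : ∀ r,
    Nat.card (family n s .code r) = 2 ^ binomSum (n + 1) r ∧
      Nat.card (family n s .prime r) * Nat.card (family n s .hat r) =
        (2 ^ binomSum (n + 1) r) ^ 2 := by
  refine family_induction (p := fun n F => ∀ r, Nat.card (F .code r) = 2 ^ binomSum (n + 1) r ∧
      Nat.card (F .prime r) * Nat.card (F .hat r) = (2 ^ binomSum (n + 1) r) ^ 2) ?_ ?_ ?_ n s
  · intro r
    have h4 : Nat.card (⊤ : AddSubgroup (Vec 0)) = 4 := by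
      rw [AddSubgroup.card_top, Nat.card_eq_fintype_card, Fintype.card_fun, ZMod.card]
      rfl
    have h1 : Nat.card (⊥ : AddSubgroup (Vec 0)) = 1 := AddSubgroup.card_bot
    rw [baseFamily_hat, baseFamily_prime, baseFamily, binomSum_succ, Layer.unit]
    obtain hr | rfl | hr : r < 0 ∨ r = 0 ∨ 1 ≤ r := by omega
    · rw [if_neg (by omega), if_neg (by omega), if_neg (by omega), if_neg (by omega),
        binomSum_of_neg _ hr, binomSum_of_neg _ (by omega), h1]
      simp
    · simp only [show ¬ (1 : ℤ) ≤ 0 by omega, le_refl, if_true, if_false]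
      rw [card_zmultiples_two, h1, h4, binomSum_of_neg 0 (show (0 : ℤ) - 1 < 0 by omega)]
      simp [binomSum]
    · have h0 (k : ℤ) (hk : 0 ≤ k) : binomSum 0 k = 1 := by
        rw [binomSum, show (k + 1).toNat = k.toNat + 1 by omega, Finset.sum_range_succ']
        simp
      rw [if_pos hr, if_pos (by omega), if_pos hr, h4, h0 _ (by omega), h0 _ (by omega)]
      simp
  · intro n s ih r
    simp only [plotkinFamily, card_plotkinSum, binomSum_succ (n + 1)]
    refine ⟨by rw [(ih _).1, (ih _).1, pow_add], ?_⟩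
    rw [mul_mul_mul_comm, (ih _).2, (ih _).2, pow_add, mul_pow]
  · intro n s ih r
    simp only [bqFamily, card_bqSum, binomSum_add_two (n + 1)]
    have h := (ih (r - 1)).2
    constructor
    · rw [(ih _).1, (ih _).1, ← mul_assoc (Nat.card (family n s .prime (r - 1))), h]
      ring
    · have h0 := (ih r).2
      have h2 := (ih (r - 2)).2
      calc _ = (Nat.card (family n s .prime r) * Nat.card (family n s .hat r)) *
            (Nat.card (family n s .prime (r - 1)) * Nat.card (family n s .hat (r - 1))) ^ 2 *
            (Nat.card (family n s .prime (r - 2)) * Nat.card (family n s .hat (r - 2))) := by ring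
        _ = _ := by rw [h, h0, h2]; ring

/-! ### Duality -/

/-- The Kronecker form of length `1` is the multiplication of `ZMod 4`. -/
theorem kroneckerInner_vec_zero (u v : Vec 0) : kroneckerInner u v = u 0 * v 0 := by
  simp only [kroneckerInner, kroneckerK, Matrix.one_mulVec]
  exact Fin.sum_univ_one _

theorem kroneckerDual_bot {n : ℕ} : kroneckerDual (⊥ : AddSubgroup (Vec n)) = ⊤ := by
  refine eq_top_iff.2 fun u _ v hv => ?_
  rw [AddSubgroup.mem_bot.1 hv, kroneckerInner_zero_right]

theorem kroneckerDual_top : kroneckerDual (⊤ : AddSubgroup (Vec 0)) = ⊥ := by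
  refine eq_bot_iff.2 fun u hu => AddSubgroup.mem_bot.2 (vec_zero_ext ?_)
  have := hu (fun _ => 1) trivial
  rwa [kroneckerInner_vec_zero, mul_one] at this

theorem kroneckerDual_zmultiples_two :
    kroneckerDual (AddSubgroup.zmultiples (fun _ => 2 : Vec 0)) =
      AddSubgroup.zmultiples (fun _ => 2) := by
  ext u
  rw [mem_kroneckerDual, AddSubgroup.mem_zmultiples_iff]
  constructor
  · intro hu
    have := hu _ (AddSubgroup.mem_zmultiples _)
    rw [kroneckerInner_vec_zero] at this
    obtain h | h := (by decide : ∀ x : ZMod 4, x * 2 = 0 → x = 0 ∨ x = 2) _ this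
    · exact ⟨0, vec_zero_ext (by simp [h])⟩
    · exact ⟨1, vec_zero_ext (by simp [h])⟩
  · rintro ⟨k, rfl⟩ v ⟨l, rfl⟩
    have h4 : (4 : ZMod 4) = 0 := by decide
    rw [kroneckerInner_vec_zero]
    simp only [Pi.smul_apply, zsmul_eq_mul]
    linear_combination (k : ZMod 4) * l * h4

/-- The dual of a Plotkin sum is the Plotkin sum of the duals in reverse order. -/
theorem kroneckerDual_plotkinSum {n : ℕ} {A B A' B' : AddSubgroup (Vec n)}
    (hA : B' = kroneckerDual A) (hB : A' = kroneckerDual B) (h : B' ≤ A') :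
    plotkinSum A' B' = kroneckerDual (plotkinSum A B) := by
  ext w
  obtain ⟨⟨a', b'⟩, rfl⟩ := plotkinHom_surjective n w
  rw [mem_plotkinSum, mem_kroneckerDual]
  constructor
  · rintro ⟨ha, hb⟩ _ ⟨⟨a, b⟩, ⟨haA, hbB⟩, rfl⟩
    have hb' := h hb
    subst hA hB
    rw [kroneckerInner_plotkinHom, ha b hbB, hb a haA, hb' b hbB]
    simp
  · intro hw
    have hb : b' ∈ B' := by
      subst hA
      intro a ha
      have := hw _ (plotkinHom_mem ha (zero_mem B))
      simpa [kroneckerInner_plotkinHom] using this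
    refine ⟨?_, hb⟩
    have hb' := h hb
    subst hB
    intro b hbB
    have := hw _ (plotkinHom_mem (zero_mem A) hbB)
    simpa [kroneckerInner_plotkinHom, hb' b hbB] using this

/-- The dual of a BQ-Plotkin sum is the BQ-Plotkin sum of the duals in reverse order. -/
theorem kroneckerDual_bqSum {n : ℕ} {A B C D A' B' C' D' : AddSubgroup (Vec n)}
    (hA : D' = kroneckerDual A) (hB : C' = kroneckerDual B) (hC : B' = kroneckerDual C)
    (hD : A' = kroneckerDual D) (h1 : D' ≤ C') (h2 : C' ≤ B') (h3 : B' ≤ A') :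
    bqSum A' B' C' D' = kroneckerDual (bqSum A B C D) := by
  ext w
  obtain ⟨⟨a', b', c', d'⟩, rfl⟩ := bqHom_surjective n w
  rw [mem_bqSum, mem_kroneckerDual]
  constructor
  · rintro ⟨ha, hb, hc, hd⟩ _ ⟨⟨a, b, c, d⟩, ⟨haA, hbB, hcC, hdD⟩, rfl⟩
    have hdC := h1 hd
    have hdB := h2 hdC
    have hcA := h3 (h2 hc)
    have hbA := h3 hb
    have hdA := h3 hdB
    subst hA hB hC hD
    rw [kroneckerInner_bqHom, ha d hdD, hb c hcC, hc b hbB, hd a haA, hdC b hbB, hdB c hcC,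
      hbA d hdD, hcA d hdD, hdA d hdD]
    simp
  · intro hw
    -- Testing against the blocks `a`, `b`, `c`, `d` in turn gives `d'`, `c'`, `b'`, `a'`; the
    -- inclusions kill the contributions of the coordinates that are already known.
    have hd : d' ∈ D' := by
      subst hA
      intro a ha
      have := hw _ (bqHom_mem ha (zero_mem B) (zero_mem C) (zero_mem D))
      simpa [kroneckerInner_bqHom] using this
    have hdC := h1 hd
    have hdB := h2 hdC
    have hdA := h3 hdB
    have hc : c' ∈ C' := by
      subst hB
      intro b hb
      have := hw _ (bqHom_mem (zero_mem A) hb (zero_mem C) (zero_mem D))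
      simpa [kroneckerInner_bqHom, hdC b hb] using this
    have hcA := h3 (h2 hc)
    have hb : b' ∈ B' := by
      subst hC
      intro c hc
      have := hw _ (bqHom_mem (zero_mem A) (zero_mem B) hc (zero_mem D))
      simpa [kroneckerInner_bqHom, hdB c hc] using this
    have hbA := h3 hb
    refine ⟨?_, hb, hc, hd⟩
    subst hD
    intro d hdD
    have := hw _ (bqHom_mem (zero_mem A) (zero_mem B) (zero_mem C) hdD)
    simpa [kroneckerInner_bqHom, hdA d hdD, hbA d hdD, hcA d hdD] using this

theorem family_mono (n s : ℕ) (t : Layer) (r : ℤ) : family n s t (r - 1) ≤ family n s t r := by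
  obtain ⟨h1, h2, h3⟩ := family_chain n s r
  obtain ⟨-, h4, h5⟩ := family_chain n s (r - 1)
  cases t
  · exact h4.trans (h5.trans h1)
  · exact h5.trans (h1.trans h2)
  · exact h1.trans (h2.trans h3)

theorem family_eq_kroneckerDual (n s : ℕ) : ∀ t (r : ℤ),
    family n s t r = kroneckerDual (family n s t.dual (n - r)) := by
  refine family_induction (p := fun n F => ∀ t (r : ℤ), F t r = kroneckerDual (F t.dual (n - r)))
    ?_ ?_ ?_ n s
  · intro t r
    have h1 : (0 : ℤ) ≤ ((0 : ℕ) - r) ↔ ¬ 1 ≤ r := by omega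
    have h2 : (1 : ℤ) ≤ ((0 : ℕ) - r) ↔ ¬ 0 ≤ r := by omega
    cases t
    · rw [Layer.dual, baseFamily_hat, baseFamily_prime, if_congr h1 rfl rfl]
      split_ifs
      exacts [kroneckerDual_bot.symm, kroneckerDual_top.symm]
    · rw [Layer.dual, baseFamily, baseFamily]
      obtain hr | rfl | hr : r < 0 ∨ r = 0 ∨ 1 ≤ r := by omega
      · rw [if_neg (by omega), if_neg (by omega), if_pos (by omega), kroneckerDual_top]
      · rw [if_neg (by omega), if_pos rfl, if_neg (by omega), if_pos (by omega)]
        exact kroneckerDual_zmultiples_two.symm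
      · rw [if_pos hr, if_neg (by omega), if_neg (by omega), kroneckerDual_bot]
    · rw [Layer.dual, baseFamily_hat, baseFamily_prime, if_congr h2 rfl rfl]
      split_ifs
      exacts [kroneckerDual_bot.symm, kroneckerDual_top.symm]
  · intro n s ih t r
    refine kroneckerDual_plotkinSum ?_ ?_ (family_mono n s t r) <;>
    · rw [ih]
      congr 2
      push_cast
      ring
  · intro n s ih t r
    obtain ⟨h1, h2, h3⟩ := family_chain n s (r - 1)
    obtain ⟨h4, h5, h6⟩ := family_chain n s r
    refine kroneckerDual_bqSum ?_ ?_ ?_ ?_ ?_ (h2.trans h3) ?_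
    iterate 4
      rw [ih]
      congr 2
      push_cast
      ring
    · have h7 : family n s .prime (r - 2) ≤ family n s .hat (r - 1) := by
        rwa [show r - 2 = r - 1 - 1 by ring]
      obtain ⟨-, h8, h9⟩ := family_chain n s (r - 2)
      cases t
      exacts [(h8.trans h9).trans h7, h9.trans h7, h7]
    · cases t
      exacts [h4, h4.trans h5, h4.trans (h5.trans h6)]

/-! ### Minimum weight -/

/-- Every nonzero codeword of order `r` has Lee weight at least `2 ^ (n + 1 - r)`. For the
BQ-Plotkin construction, `d` is a signed sum of the four blocks; if `d = 0`, then `2b + c` is the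
difference of blocks in two disjoint ways; and if `d = 2b + c = 0`, then so is `b`, and `2b = -c`
lies in the layer `hat`, so that `b` belongs to the layer `code` and the bound applies to it. -/
theorem le_leeWeight_of_mem_family (n s : ℕ) : ∀ r : ℕ, ∀ u ∈ family n s .code r, u ≠ 0 →
    2 ^ (n + 1) ≤ 2 ^ r * leeWeight u := by
  refine family_induction (p := fun n F => ∀ r : ℕ, ∀ u ∈ F .code r, u ≠ 0 →
    2 ^ (n + 1) ≤ 2 ^ r * leeWeight u) ?_ ?_ ?_ n s
  · intro r u hu h0
    obtain rfl | hr := Nat.eq_zero_or_pos r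
    · rw [baseFamily, if_neg (by simp), if_pos (by simp)] at hu
      obtain ⟨k, rfl⟩ := hu
      have h1 : leeWeight (k • fun _ => Layer.code.unit : Vec 0) = leeWt (k * 2) := by
        refine (Fin.sum_univ_one _).trans ?_
        simp [Layer.unit]
      have h2 : (k : ZMod 4) * 2 ≠ 0 := by
        intro h
        refine h0 (vec_zero_ext ?_)
        simpa [Layer.unit] using h
      refine le_trans ?_ (Nat.mul_le_mul_left _ h1.ge)
      revert h2
      generalize (k : ZMod 4) = x
      revert x
      decide
    · calc 2 ^ (0 + 1) ≤ 2 ^ r * 1 := by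
            rw [mul_one]
            exact Nat.pow_le_pow_right two_pos hr
        _ ≤ _ := Nat.mul_le_mul_left _ (leeWeight_pos h0)
  · rintro n s ih r _ ⟨⟨a, b⟩, ⟨ha, hb⟩, rfl⟩ h0
    have hw : leeWeight (plotkinHom n (a, b)) = leeWeight a + leeWeight (a + b) := leeWeight_cat _ _
    rw [hw]
    by_cases hb0 : b = 0
    · subst hb0
      have := ih r a ha (by rintro rfl; exact h0 (map_zero (plotkinHom n)))
      rw [add_zero, pow_succ]
      linarith
    · obtain rfl | ⟨k, rfl⟩ : r = 0 ∨ ∃ k, r = k + 1 := by cases r <;> simp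
      · have hb' : b ∈ family n s .code (0 - 1) := by simpa using hb
        rw [family_of_neg _ _ _ _ (by omega)] at hb'
        exact absurd (AddSubgroup.mem_bot.1 hb') hb0
      · have := ih k b (by simpa using hb) hb0
        have h1 := leeWeight_sub_le (a + b) a
        rw [add_sub_cancel_left] at h1
        have h2 := Nat.mul_le_mul_left (2 ^ k) h1
        rw [pow_succ _ (n + 1), pow_succ _ k]
        linarith
  · rintro n s ih r _ ⟨⟨a, b, c, d⟩, ⟨ha, hb, hc, hd⟩, rfl⟩ h0
    have hw : leeWeight (bqHom n (a, b, c, d)) = leeWeight a + leeWeight (a + b) +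
        (leeWeight (a + 2 • b + c) + leeWeight (a + 3 • b + c + d)) := by
      simp only [bqHom, AddMonoidHom.coe_mk, ZeroHom.coe_mk, cat4, leeWeight_cat]
    rw [hw, show n + 2 + 1 = n + 1 + 1 + 1 by ring, pow_succ, pow_succ]
    simp only at ha hb hc hd
    by_cases hd0 : d = 0
    · subst hd0
      rw [add_zero]
      obtain rfl | ⟨k, rfl⟩ : r = 0 ∨ ∃ k, r = k + 1 := by cases r <;> simp
      · rw [family_of_neg _ _ _ _ (by simp)] at hb hc
        obtain rfl := AddSubgroup.mem_bot.1 hb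
        obtain rfl := AddSubgroup.mem_bot.1 hc
        have := ih 0 a ha (by rintro rfl; exact h0 (map_zero (bqHom n)))
        simp only [smul_zero, add_zero]
        linarith
      · rw [Nat.cast_add_one, add_sub_cancel_right] at hb hc
        have he : 2 • b + c ∈ family n s .code k := add_mem (two_nsmul_mem_family n s _ _ hb)
          ((family_chain n s _).2.1 hc)
        by_cases he0 : 2 • b + c = 0
        · have hbc : b ∈ family n s .code k := by
            refine mem_code_of_two_nsmul n s _ _ hb ?_
            rw [eq_neg_of_add_eq_zero_left he0]
            exact neg_mem hc
          have e2 : a + 2 • b + c = a := by rw [add_assoc, he0, add_zero]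
          have e3 : a + 3 • b + c = a + b := by
            rw [show a + 3 • b + c = a + b + (2 • b + c) by abel, he0, add_zero]
          rw [e2, e3]
          by_cases hb0 : b = 0
          · subst hb0
            obtain rfl : c = 0 := by simpa using he0
            have := ih (k + 1) a ha (by rintro rfl; exact h0 (map_zero (bqHom n)))
            rw [add_zero]
            linarith
          · have := ih k b hbc hb0
            have h1 := leeWeight_sub_le (a + b) a
            rw [add_sub_cancel_left] at h1
            have h2 := Nat.mul_le_mul_left (2 ^ k) h1
            rw [pow_succ _ k]
            linarith
        · have := ih k _ he he0
          have h1 := leeWeight_sub_le (a + 2 • b + c) a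
          rw [show a + 2 • b + c - a = 2 • b + c by abel] at h1
          have h2 := leeWeight_sub_le (a + 3 • b + c) (a + b)
          rw [show a + 3 • b + c - (a + b) = 2 • b + c by abel] at h2
          have h3 := Nat.mul_le_mul_left (2 ^ k) (add_le_add h1 h2)
          rw [pow_succ _ k]
          linarith
    · obtain hr | ⟨k, rfl⟩ : r < 2 ∨ ∃ k, r = k + 2 := by
        obtain h | h := lt_or_ge r 2
        exacts [Or.inl h, Or.inr ⟨r - 2, by omega⟩]
      · rw [family_of_neg _ _ _ _ (by omega)] at hd
        exact absurd (AddSubgroup.mem_bot.1 hd) hd0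
      · rw [Nat.cast_add, Nat.cast_ofNat, add_sub_cancel_right] at hd
        have := ih k d hd hd0
        have h1 := leeWeight_sub_le (a + (a + 3 • b + c + d)) (a + b + (a + 2 • b + c))
        rw [show a + (a + 3 • b + c + d) - (a + b + (a + 2 • b + c)) = d by abel] at h1
        have h2 := leeWeight_add_le a (a + 3 • b + c + d)
        have h3 := leeWeight_add_le (a + b) (a + 2 • b + c)
        have h4 := Nat.mul_le_mul_left (2 ^ k) (h1.trans (add_le_add h2 h3))
        rw [pow_add _ k]
        linarith

theorem exists_leeWeight_eq (n s : ℕ) : ∀ r : ℕ, r ≤ n + 1 →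
    ∃ u ∈ family n s .code r, 2 ^ r * leeWeight u = 2 ^ (n + 1) := by
  refine family_induction (p := fun n F => ∀ r : ℕ, r ≤ n + 1 →
    ∃ u ∈ F .code r, 2 ^ r * leeWeight u = 2 ^ (n + 1)) ?_ ?_ ?_ n s
  · intro r hr
    have hw (x : ZMod 4) : leeWeight (fun _ => x : Vec 0) = leeWt x := Fin.sum_univ_one _
    obtain rfl | rfl : r = 0 ∨ r = 1 := by omega
    · refine ⟨fun _ => 2, ?_, by rw [hw]; rfl⟩
      rw [baseFamily, if_neg (by simp), if_pos (by simp)]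
      exact AddSubgroup.mem_zmultiples _
    · refine ⟨fun _ => 1, ?_, by rw [hw]; rfl⟩
      rw [baseFamily, if_pos (by simp)]
      trivial
  · intro n s ih r hr
    obtain hr | rfl := Nat.le_succ_iff.1 hr
    · obtain ⟨a, ha, hw⟩ := ih r hr
      refine ⟨_, plotkinHom_mem ha (zero_mem _), ?_⟩
      simp only [plotkinHom, AddMonoidHom.coe_mk, ZeroHom.coe_mk, leeWeight_cat, add_zero]
      rw [mul_add, hw, ← mul_two, ← pow_succ]
    · obtain ⟨b, hb, hw⟩ := ih (n + 1) le_rfl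
      refine ⟨_, plotkinHom_mem (zero_mem _) (b := b) (by simpa using hb), ?_⟩
      simp only [plotkinHom, AddMonoidHom.coe_mk, ZeroHom.coe_mk, leeWeight_cat, zero_add,
        leeWeight_zero]
      rw [Nat.succ_eq_add_one, pow_succ _ (n + 1), mul_right_comm, hw]
  · intro n s ih r hr
    obtain hr' | ⟨k, rfl⟩ : r ≤ n + 1 ∨ ∃ k, r = k + 2 := by
      obtain h | h := le_or_gt r (n + 1)
      exacts [Or.inl h, Or.inr ⟨r - 2, by omega⟩]
    · obtain ⟨a, ha, hw⟩ := ih r hr'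
      refine ⟨_, bqHom_mem ha (zero_mem _) (zero_mem _) (zero_mem _), ?_⟩
      simp only [bqHom, AddMonoidHom.coe_mk, ZeroHom.coe_mk, cat4, leeWeight_cat, add_zero,
        smul_zero]
      rw [mul_add, mul_add, hw]
      ring
    · obtain ⟨d, hd, hw⟩ := ih k (by omega)
      refine ⟨_, bqHom_mem (zero_mem _) (zero_mem _) (zero_mem _) (d := d) (by simpa using hd), ?_⟩
      simp only [bqHom, AddMonoidHom.coe_mk, ZeroHom.coe_mk, cat4, leeWeight_cat, add_zero,
        smul_zero, leeWeight_zero, zero_add]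
      rw [pow_add, mul_right_comm, hw, ← pow_add, add_right_comm]

/-! ### The generator matrices generate the layers -/

/-- The rows of a generator matrix that generate the given layer. -/
def GenMatrix.rows {N : ℕ} (G : GenMatrix N) : Layer → List (Fin N → ZMod 4)
  | .hat => G.hatRows
  | .code => G.two ++ G.four
  | .prime => G.primeRows

/-- The layers of the code generated by a generator matrix. -/
def GenMatrix.layer {N : ℕ} (G : GenMatrix N) (t : Layer) : AddSubgroup (Fin N → ZMod 4) :=
  AddSubgroup.closure {u | u ∈ G.rows t}

/-- Halving the rows of order two commutes with concatenation. -/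
theorem half_cat {n : ℕ} (u v : Vec n) :
    (fun i => if cat u v i = 2 then 1 else cat u v i) =
      cat (fun i => if u i = 2 then 1 else u i) (fun i => if v i = 2 then 1 else v i) :=
  funext (forall_halves.2 ⟨fun b => by simp, fun b => by simp⟩)

theorem half_zero {n : ℕ} :
    (fun i => if (0 : Vec n) i = 2 then 1 else (0 : Vec n) i) = 0 := by
  funext i
  rw [Pi.zero_apply, if_neg (by decide)]

theorem layer_plotkin {n : ℕ} (A B : GenMatrix (2 ^ n)) (t : Layer) :
    (plotkin A B).layer t = plotkinSum (A.layer t) (B.layer t) := by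
  rw [GenMatrix.layer, GenMatrix.layer, GenMatrix.layer, ← closure_plotkin]
  congr 1
  ext w
  cases t
  · simp [GenMatrix.rows, GenMatrix.hatRows, plotkin]
  · simp only [GenMatrix.rows, plotkin, Set.mem_ofPred_eq, List.mem_append, List.mem_map,
      Set.mem_union, Set.mem_image, or_and_right, exists_or]
    exact or_or_or_comm
  · simp only [GenMatrix.rows, GenMatrix.primeRows, plotkin, Set.mem_ofPred_eq, List.mem_append,
      List.mem_map, Set.mem_union, Set.mem_image, or_and_right, exists_or, List.map_append,
      List.map_map, Function.comp_def, half_cat, half_zero, exists_exists_and_eq_and]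
    exact or_or_or_comm

theorem or_block_comm (a b c d e f : Prop) :
    (a ∨ b) ∨ ((c ∨ d) ∨ e) ∨ f ↔ (((a ∨ c) ∨ d) ∨ e) ∨ b ∨ f := by
  tauto

theorem layer_bqPlotkin {n : ℕ} (A B C : GenMatrix (2 ^ n)) (t : Layer) :
    (bqPlotkin A B C).layer t =
      bqSum (A.layer t) (B.layer .prime) (B.layer .hat) (C.layer t) := by
  rw [GenMatrix.layer, GenMatrix.layer, GenMatrix.layer, GenMatrix.layer, GenMatrix.layer,
    ← closure_bq]
  congr 1
  ext w
  cases t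
  · simp [GenMatrix.rows, GenMatrix.hatRows, bqPlotkin, or_assoc]
  · simp only [GenMatrix.rows, bqPlotkin, Set.mem_ofPred_eq, List.mem_append, List.mem_map,
      Set.mem_union, Set.mem_image, or_and_right, exists_or]
    exact or_block_comm _ _ _ _ _ _
  · simp only [GenMatrix.rows, GenMatrix.primeRows, bqPlotkin, Set.mem_ofPred_eq, List.mem_append,
      List.mem_map, Set.mem_union, Set.mem_image, or_and_right, exists_or, List.map_append, cat4,
      List.map_map, Function.comp_def, half_cat, half_zero, exists_exists_and_eq_and]
    exact or_block_comm _ _ _ _ _ _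

theorem closure_single {N : ℕ} : AddSubgroup.closure
    {u | u ∈ List.ofFn (fun i : Fin N => (Pi.single i 1 : Fin N → ZMod 4))} = ⊤ := by
  refine eq_top_iff.2 fun u _ => ?_
  rw [← Finset.univ_sum_single u]
  refine sum_mem fun i _ => ?_
  have : Pi.single i (u i) = (u i).val • (Pi.single i 1 : Fin N → ZMod 4) := by
    rw [← Pi.single_smul, nsmul_eq_mul, mul_one, ZMod.natCast_zmod_val]
  rw [this]
  exact AddSubgroup.nsmul_mem _ (AddSubgroup.subset_closure
    (show _ ∈ {v | v ∈ List.ofFn _} from List.mem_ofFn.2 ⟨i, rfl⟩)) _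

theorem layer_empty {N : ℕ} (t : Layer) : (⟨[], []⟩ : GenMatrix N).layer t = ⊥ := by
  rw [GenMatrix.layer]
  cases t <;> simp [GenMatrix.rows, GenMatrix.hatRows, GenMatrix.primeRows]

theorem layer_order_zero {N : ℕ} (t : Layer) :
    (⟨[fun _ => 2], []⟩ : GenMatrix N).layer t = AddSubgroup.zmultiples (fun _ => t.unit) := by
  rw [GenMatrix.layer, AddSubgroup.zmultiples_eq_closure]
  cases t
  · simp only [GenMatrix.rows, GenMatrix.hatRows, List.not_mem_nil, Set.ofPred_false,
      AddSubgroup.closure_empty]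
    exact AddSubgroup.closure_singleton_zero.symm
  · simp [GenMatrix.rows, Layer.unit]
  · simp [GenMatrix.rows, GenMatrix.primeRows, Layer.unit]

theorem layer_identity {N : ℕ} (t : Layer) :
    (⟨[], List.ofFn (fun i : Fin N => Pi.single i 1)⟩ : GenMatrix N).layer t = ⊤ := by
  rw [GenMatrix.layer, ← closure_single]
  cases t <;> simp [GenMatrix.rows, GenMatrix.hatRows, GenMatrix.primeRows]

/-- The special treatment of the extreme orders does not change any layer. -/
theorem layer_withExtremes {n s : ℕ} {t : Layer} {r : ℤ} {G : GenMatrix (2 ^ n)}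
    (h : G.layer t = family n s t r) : (withExtremes (n + 1) r G).layer t = family n s t r := by
  rw [withExtremes]
  split_ifs with h1 h2 h3
  · rw [family_of_neg _ _ _ _ h1, layer_empty]
  · rw [h2, family_zero, layer_order_zero]
  · rw [family_of_lt _ _ _ _ (by push_cast at h3; omega), layer_identity]
  · exact h

theorem layer_genRM : ∀ (n s : ℕ) (r : ℤ) (t : Layer), (genRM n s r).layer t = family n s t r
  | 0, s, r, t => by
    -- For length one all orders are extreme, so the matrix in the default branch is irrelevant.
    rw [genRM, withExtremes]
    by_cases h1 : r < 0
    · rw [if_pos h1, family_of_neg _ _ _ _ h1, layer_empty]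
    · by_cases h2 : r = 0
      · subst h2
        rw [if_neg h1, if_pos rfl, layer_order_zero, family_zero]
      · rw [if_neg h1, if_neg h2, if_pos (by push_cast; omega), layer_identity,
          family_of_lt _ _ _ _ (by push_cast; omega)]
  | 1, s, r, t => by
    rw [genRM]
    refine layer_withExtremes ?_
    rw [layer_plotkin, layer_genRM, layer_genRM]
    rfl
  | n + 2, s, r, t => by
    rw [genRM]
    refine layer_withExtremes ?_
    rw [family]
    split_ifs
    · rw [layer_bqPlotkin, layer_genRM, layer_genRM, layer_genRM, layer_genRM]
      rfl
    · rw [layer_plotkin, layer_genRM, layer_genRM]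
      rfl

theorem RM_succ (n s : ℕ) (r : ℤ) : RM s r (n + 1) = family n s .code r :=
  layer_genRM n s r .code

/-! ### The Gray map -/

theorem sum_grayMap {N : ℕ} {M : Type*} [AddCommMonoid M] (f : Fin N → Fin 2 → M) :
    ∑ j : Fin (N * 2), f j.divNat j.modNat = ∑ i, (f i 0 + f i 1) := by
  refine (finProdFinEquiv.symm.sum_comp fun p : Fin N × Fin 2 => f p.1 p.2).trans ?_
  simp only [Fintype.sum_prod_type, Fin.sum_univ_two]

theorem hammingDist_eq_sum {ι : Type*} [Fintype ι] (x y : ι → ZMod 2) :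
    hammingDist x y = ∑ i, if x i ≠ y i then 1 else 0 := by
  rw [hammingDist, Finset.card_filter]

/-- The Gray map is an isometry. -/
theorem hammingDist_grayMap {N : ℕ} (u v : Fin N → ZMod 4) :
    hammingDist (grayMap u) (grayMap v) = leeDist u v := by
  rw [hammingDist_eq_sum]
  refine (sum_grayMap fun i k => if gray (u i) k ≠ gray (v i) k then 1 else 0).trans ?_
  exact Finset.sum_congr rfl fun i _ => (by decide : ∀ x y : ZMod 4,
    ((if gray x 0 ≠ gray y 0 then 1 else 0) + if gray x 1 ≠ gray y 1 then 1 else 0) =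
      leeWt (x - y)) (u i) (v i)

theorem grayMap_injective {N : ℕ} : Function.Injective (grayMap (N := N)) := fun u v h => by
  by_contra hne
  have h1 := leeWeight_pos (sub_ne_zero.2 hne)
  have h2 := hammingDist_grayMap u v
  rw [h, hammingDist_self, leeDist] at h2
  omega

theorem grayMap_add_two {N : ℕ} (u : Fin N → ZMod 4) :
    grayMap (u + fun _ => 2) = grayMap u + 1 :=
  funext fun j => (by decide : ∀ (x : ZMod 4) (k : Fin 2), gray (x + 2) k = gray x k + 1) _ _

theorem sum_grayMap_eq_leeWeight {N : ℕ} (u : Fin N → ZMod 4) :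
    ∑ j, grayMap u j = (leeWeight u : ZMod 2) := by
  refine (sum_grayMap fun i k => gray (u i) k).trans ?_
  rw [leeWeight, Nat.cast_sum]
  exact Finset.sum_congr rfl fun i _ =>
    (by decide : ∀ x : ZMod 4, gray x 0 + gray x 1 = (leeWt x : ZMod 2)) (u i)

theorem ncard_grayImage {N : ℕ} (C : AddSubgroup (Fin N → ZMod 4)) :
    (grayImage C).ncard = Nat.card C := by
  rw [grayImage, Set.ncard_image_of_injective _ grayMap_injective, ← Nat.card_coe_set_eq]
  rfl

theorem hasMinHammingDist_grayImage {N d : ℕ} {C : AddSubgroup (Fin N → ZMod 4)}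
    (h : HasMinLeeDist C d) : HasMinHammingDist (grayImage C) d := by
  obtain ⟨⟨u, hu, v, hv, huv, hd⟩, hmin⟩ := h
  refine ⟨⟨_, ⟨u, hu, rfl⟩, _, ⟨v, hv, rfl⟩, grayMap_injective.ne huv, ?_⟩, ?_⟩
  · rw [hammingDist_grayMap, hd]
  · rintro _ ⟨_, ⟨x, hx, rfl⟩, _, ⟨y, hy, rfl⟩, hxy, rfl⟩
    rw [hammingDist_grayMap]
    exact hmin ⟨x, hx, y, hy, ne_of_apply_ne _ hxy, rfl⟩

/-! ### Criteria for Hadamard and extended perfect codes -/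

/-- A self-complementary binary code of length `n` with `2 n` codewords is a Hadamard code if
codewords that are neither equal nor complementary agree in half of the positions. The Hadamard
matrix has as rows the codewords that begin with `0`. -/
theorem isHadamardCode_of_hammingDist {n : ℕ} (hn : 0 < n) {B : Set (Fin n → ZMod 2)}
    (hcard : B.ncard = 2 * n) (hcompl : ∀ x ∈ B, x + 1 ∈ B)
    (hd : ∀ x ∈ B, ∀ y ∈ B, x ≠ y → y ≠ x + 1 → 2 * hammingDist x y = n) :
    IsHadamardCode B := by
  have h11 (x : Fin n → ZMod 2) : x + 1 + 1 = x :=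
    funext fun j => (by decide : ∀ a : ZMod 2, a + 1 + 1 = a) (x j)
  let p : Fin n := ⟨0, hn⟩
  let T : Set (Fin n → ZMod 2) := {x | x ∈ B ∧ x p = 0}
  have hBT : B = T ∪ (fun x => x + 1) '' T := by
    ext x
    constructor
    · intro hx
      obtain h0 | h0 := (by decide : ∀ a : ZMod 2, a = 0 ∨ a + 1 = 0) (x p)
      · exact Or.inl ⟨hx, h0⟩
      · exact Or.inr ⟨x + 1, ⟨hcompl x hx, h0⟩, h11 x⟩
    · rintro (hx | ⟨y, hy, rfl⟩)
      exacts [hx.1, hcompl y hy.1]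
  have hdisj : Disjoint T ((fun x => x + 1) '' T) := by
    rw [Set.disjoint_left]
    rintro _ hx ⟨y, hy, rfl⟩
    have h1 : y p + 1 = 0 := hx.2
    rw [hy.2] at h1
    exact absurd h1 (by decide)
  have hT : Nat.card T = n := by
    rw [Nat.card_coe_set_eq]
    rw [hBT, Set.ncard_union_eq hdisj (Set.toFinite _) (Set.toFinite _),
      Set.ncard_image_of_injective _ (add_left_injective 1)] at hcard
    omega
  let e : Fin n ≃ T := (Finite.equivFinOfCardEq hT).symm
  let H : Matrix (Fin n) (Fin n) ℤ := fun i j => if (e i).1 j = 0 then 1 else -1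
  have hmul (x y : Fin n → ZMod 2) :
      ∑ j, (if x j = 0 then (1 : ℤ) else -1) * (if y j = 0 then 1 else -1) =
        n - 2 * hammingDist x y := by
    have hn' : (n : ℤ) = ∑ _j : Fin n, 1 := by simp
    rw [hammingDist_eq_sum, hn', Nat.cast_sum, Finset.mul_sum, ← Finset.sum_sub_distrib]
    exact Finset.sum_congr rfl fun j _ => (by decide : ∀ a b : ZMod 2,
      (if a = 0 then (1 : ℤ) else -1) * (if b = 0 then 1 else -1) =
        1 - 2 * ((if a ≠ b then 1 else 0 : ℕ) : ℤ)) (x j) (y j)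
  refine ⟨H, ?_, ?_⟩
  · have hentry (i j) : H i j = 1 ∨ H i j = -1 := by
      by_cases h : (e i).1 j = 0
      exacts [Or.inl (if_pos h), Or.inr (if_neg h)]
    refine Matrix.IsHadamard.of_mul_conjTranspose ?_ ?_ ?_
    · intro i j
      obtain h | h := hentry i j <;> simp [h, Unitary.mem_iff]
    · ext i k
      rw [Matrix.mul_apply, Matrix.smul_apply, Matrix.one_apply, Fintype.card_fin]
      refine (hmul (e i).1 (e k).1).trans ?_
      split_ifs with h
      · subst h
        simp
      · have h1 := hd _ (e i).2.1 _ (e k).2.1 (fun h2 => h (e.injective (Subtype.ext h2))) (by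
          intro h2
          have h3 : (e k).1 p = (e i).1 p + 1 := congrFun h2 p
          rw [(e i).2.2, (e k).2.2] at h3
          exact absurd h3 (by decide))
        simp only [smul_eq_mul, mul_zero]
        omega
    · rw [Fintype.card_fin]
      exact IsRegular.of_ne_zero (by exact_mod_cast hn.ne')
  · have hone (i j) : H i j = 1 ↔ (e i).1 j = 0 := by
      by_cases h : (e i).1 j = 0 <;> simp [H, h]
    have hneg (i j) : H i j = -1 ↔ (e i).1 j + 1 = 0 := by
      rw [← (by decide : ∀ a : ZMod 2, ¬ a = 0 ↔ a + 1 = 0)]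
      by_cases h : (e i).1 j = 0 <;> simp [H, h]
    have hext (x y : Fin n → ZMod 2) : (∀ j, x j = 0 ↔ y j = 0) ↔ x = y := by
      rw [funext_iff]
      exact forall_congr' fun j => (by decide : ∀ a b : ZMod 2, (a = 0 ↔ b = 0) ↔ a = b) _ _
    ext x
    have hone' (i) : (∀ j, x j = 0 ↔ H i j = 1) ↔ x = (e i).1 := by
      simp only [hone]
      exact hext x _
    have hneg' (i) : (∀ j, x j = 0 ↔ H i j = -1) ↔ x = (e i).1 + 1 := by
      simp only [hneg]
      exact hext x _
    simp only [Set.mem_ofPred_eq, hone', hneg']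
    rw [hBT]
    constructor
    · rintro (hx | ⟨y, hy, rfl⟩)
      · exact ⟨e.symm ⟨x, hx⟩, Or.inl (by simp)⟩
      · exact ⟨e.symm ⟨y, hy⟩, Or.inr (by simp)⟩
    · rintro ⟨i, rfl | rfl⟩
      exacts [Or.inl (e i).2, Or.inr ⟨_, (e i).2, rfl⟩]

/-- A binary code of even weight vectors with minimum distance at least `4` which meets the sphere
packing bound after puncturing is an extended perfect code: the balls of radius `1` around the
punctured codewords are disjoint, and they fill the space by counting. -/
theorem isExtendedPerfectCode_of_hammingDist {n : ℕ} (p : Fin n) {B : Set (Fin n → ZMod 2)}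
    (heven : ∀ x ∈ B, ∑ i, x i = 0) (hd : ∀ x ∈ B, ∀ y ∈ B, x ≠ y → 4 ≤ hammingDist x y)
    (hcard : B.ncard * n = 2 ^ (n - 1)) : IsExtendedPerfectCode B := by
  let res (x : Fin n → ZMod 2) : {i : Fin n // i ≠ p} → ZMod 2 := fun i => x i
  have hres (x y) : hammingDist x y ≤ 1 + hammingDist (res x) (res y) := by
    rw [hammingDist_eq_sum, hammingDist_eq_sum, Fintype.sum_eq_add_sum_subtype_ne _ p]
    refine Nat.add_le_add_right ?_ _
    split_ifs <;> simp
  have hclose {x y} (hx : x ∈ B) (hy : y ∈ B) {z} (h1 : hammingDist z (res x) ≤ 1)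
      (h2 : hammingDist z (res y) ≤ 1) : x = y := by
    by_contra hne
    have h3 := hd x hx y hy hne
    have h4 := hres x y
    have h5 := hammingDist_triangle_left (res x) (res y) z
    omega
  let err (o : Option {i : Fin n // i ≠ p}) : {i : Fin n // i ≠ p} → ZMod 2 :=
    o.elim 0 fun i => Pi.single i 1
  have herr_inj : Function.Injective err := by
    rintro (_ | i) (_ | j) h
    · rfl
    · exact absurd (congrFun h j) (by simp [err])
    · exact absurd (congrFun h i) (by simp [err])
    · by_contra hij
      have hij' : i ≠ j := fun h' => hij (congrArg some h')
      exact absurd (congrFun h i) (by simp [err, hij'])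
  have herr (c : {i : Fin n // i ≠ p} → ZMod 2) (o) : hammingDist (c + err o) c ≤ 1 := by
    rw [hammingDist, Finset.card_le_one]
    rcases o with _ | i
    · simp [err]
    · intro a ha b hb
      simp only [err, Pi.add_apply, Option.elim_some] at ha hb
      have ha' : a = i := by
        by_contra h
        simp [h] at ha
      have hb' : b = i := by
        by_contra h
        simp [h] at hb
      rw [ha', hb']
  let f (q : B × Option {i : Fin n // i ≠ p}) : {i : Fin n // i ≠ p} → ZMod 2 :=
    res q.1 + err q.2
  have hf : Function.Bijective f := by
    refine Function.Injective.bijective_of_nat_card_le ?_ ?_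
    · rintro ⟨x, o⟩ ⟨y, o'⟩ h
      have h' : res x + err o = res y + err o' := h
      have hxy : x = y := Subtype.ext (hclose x.2 y.2 (herr (res x) o) (h' ▸ herr (res y) o'))
      subst hxy
      rw [herr_inj (add_left_cancel h')]
    · rw [Nat.card_prod, Nat.card_coe_set_eq]
      have hι : Nat.card {i : Fin n // i ≠ p} = n - 1 := by
        rw [Nat.card_eq_fintype_card, Fintype.card_subtype_compl]
        simp
      have h1 : Nat.card (Option {i : Fin n // i ≠ p}) = n := by
        rw [Finite.card_option, hι]
        have := p.pos
        omega
      rw [h1, hcard, Nat.card_fun, hι, Nat.card_zmod]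
  refine ⟨p, res '' B, ?_, ?_⟩
  · intro z
    obtain ⟨⟨x, o⟩, rfl⟩ := hf.2 z
    refine ⟨res x, ⟨⟨x, x.2, rfl⟩, herr _ _⟩, ?_⟩
    rintro _ ⟨⟨y, hy, rfl⟩, h⟩
    rw [hclose hy x.2 h (herr _ _)]
  · ext x
    constructor
    · intro hx
      exact ⟨⟨x, hx, rfl⟩, heven x hx⟩
    · rintro ⟨⟨c, hc, hcx⟩, hx⟩
      have hc0 := heven c hc
      rw [Fintype.sum_eq_add_sum_subtype_ne _ p] at hc0 hx
      have hsum : ∑ i : {i : Fin n // i ≠ p}, c i = ∑ i : {i : Fin n // i ≠ p}, x i :=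
        Finset.sum_congr rfl fun i _ => congrFun hcx i
      have hp : c p = x p := by
        rw [hsum] at hc0
        exact add_right_cancel (hc0.trans hx.symm)
      convert hc using 1
      funext i
      by_cases hi : i = p
      · rw [hi, hp]
      · exact (congrFun hcx ⟨i, hi⟩).symm

/-! ### The parameters of the Reed-Muller codes -/

theorem card_family (n s : ℕ) (r : ℤ) :
    Nat.card (family n s .code r) = 2 ^ binomSum (n + 1) r :=
  (card_code_and_card_prime_mul_card_hat n s r).1

theorem hasMinLeeDist_family (n s r : ℕ) (hr : r ≤ n + 1) :
    HasMinLeeDist (family n s .code r) (2 ^ (n + 1 - r)) := by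
  have hpow : 2 ^ (n + 1) = 2 ^ r * 2 ^ (n + 1 - r) := by rw [← pow_add, Nat.add_sub_cancel' hr]
  constructor
  · obtain ⟨u, hu, hw⟩ := exists_leeWeight_eq n s r hr
    rw [hpow] at hw
    have hw' := Nat.eq_of_mul_eq_mul_left (by positivity) hw
    refine ⟨u, hu, 0, zero_mem _, ?_, by rw [leeDist, sub_zero, hw']⟩
    rintro rfl
    rw [leeWeight_zero] at hw'
    exact absurd hw'.symm (by positivity)
  · rintro _ ⟨u, hu, v, hv, huv, rfl⟩
    have := le_leeWeight_of_mem_family n s r _ (sub_mem hu hv) (sub_ne_zero.2 huv)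
    rw [hpow] at this
    exact Nat.le_of_mul_le_mul_left this (by positivity)

theorem mem_family_zero {n s : ℕ} {u : Vec n} :
    u ∈ family n s .code 0 ↔ u = 0 ∨ u = fun _ => 2 := by
  rw [family_zero, AddSubgroup.mem_zmultiples_iff]
  constructor
  · rintro ⟨k, rfl⟩
    have h := (by decide : ∀ x : ZMod 4, x * 2 = 0 ∨ x * 2 = 2) k
    refine h.imp (fun h => ?_) fun h => ?_ <;>
    · funext i
      simpa [Layer.unit] using h
  · rintro (rfl | rfl)
    exacts [⟨0, by simp⟩, ⟨1, by simp [Layer.unit]⟩]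

theorem two_mem_family_one (n s : ℕ) : (fun _ => 2 : Vec n) ∈ family n s .code 1 :=
  family_mono n s .code 1 (by rw [sub_self]; exact mem_family_zero.2 (Or.inr rfl))

/-- The code of order `n` is the dual of `{0, (2 ⋯ 2)}`. -/
theorem mem_family_even {n s : ℕ} {u : Vec n} :
    u ∈ family n s .code n ↔ Even (leeWeight u) := by
  rw [family_eq_kroneckerDual, mem_kroneckerDual, Layer.dual, sub_self]
  have h2 : 2 * (leeWeight u : ZMod 4) = 0 ↔ Even (leeWeight u) := by
    rw [show (2 : ZMod 4) * leeWeight u = ((2 * leeWeight u : ℕ) : ZMod 4) by push_cast; rfl,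
      ZMod.natCast_eq_zero_iff, even_iff_two_dvd, show 4 = 2 * 2 from rfl,
      Nat.mul_dvd_mul_iff_left two_pos]
  rw [← h2, ← kroneckerInner_two]
  constructor
  · exact fun h => h _ (mem_family_zero.2 (Or.inr rfl))
  · intro h v hv
    obtain rfl | rfl := mem_family_zero.1 hv
    exacts [kroneckerInner_zero_right u, h]

/-- In the code of order `1` all vectors other than `0` and `(2 ⋯ 2)` have the same Lee weight:
`u` and `u + (2 ⋯ 2)` both have at least half of the maximal weight, and their weights add up to
the maximal weight. -/
theorem leeWeight_of_mem_family_one {n s : ℕ} {u : Vec n} (hu : u ∈ family n s .code 1)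
    (h0 : u ≠ 0) (h2 : u ≠ fun _ => 2) : 2 * leeWeight u = 2 ^ n * 2 := by
  have hne : (u + fun _ => 2) ≠ 0 := by
    intro h
    refine h2 (funext fun i => ?_)
    exact (by decide : ∀ x : ZMod 4, x + 2 = 0 → x = 2) _ (congrFun h i)
  have h3 := le_leeWeight_of_mem_family n s 1 u (by simpa using hu) h0
  have h4 := le_leeWeight_of_mem_family n s 1 _
    (by simpa using add_mem hu (two_mem_family_one n s)) hne
  have h5 := leeWeight_add_two u
  rw [pow_succ, pow_one] at h3 h4
  omega

theorem isHadamardCode_family (n s : ℕ) : IsHadamardCode (grayImage (family n s .code 1)) := by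
  refine isHadamardCode_of_hammingDist (by positivity) ?_ ?_ ?_
  · rw [ncard_grayImage, card_family, show (1 : ℤ) = (1 : ℕ) from rfl, binomSum_natCast]
    simp only [Finset.sum_range_succ, Finset.sum_range_zero, Nat.choose_zero_right,
      Nat.choose_one_right]
    ring
  · rintro _ ⟨u, hu, rfl⟩
    exact ⟨_, add_mem hu (two_mem_family_one n s), grayMap_add_two u⟩
  · rintro _ ⟨u, hu, rfl⟩ _ ⟨v, hv, rfl⟩ huv huv'
    rw [hammingDist_grayMap, leeDist]
    refine leeWeight_of_mem_family_one (sub_mem hu hv)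
      (sub_ne_zero.2 (ne_of_apply_ne _ huv)) fun h => huv' ?_
    rw [← grayMap_add_two, ← h]
    congr 1
    funext i
    have := congrFun h i
    exact (by decide : ∀ x y : ZMod 4, x - y = 2 → y = x + (x - y)) _ _ this

/-- The code of order `n - 1` has redundancy `n + 2`, as an extended Hamming code of length
`2 ^ (n + 1)`. -/
theorem binomSum_sub_two (n : ℕ) : binomSum (n + 1) (n - 1) + (n + 1) + 1 = 2 ^ (n + 1) := by
  rw [← Nat.sum_range_choose, Finset.sum_range_succ, Finset.sum_range_succ, Nat.choose_self,
    Nat.choose_succ_self_right, binomSum, sub_add_cancel, Int.toNat_natCast]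

theorem isExtendedPerfectCode_family (n s : ℕ) :
    IsExtendedPerfectCode (grayImage (family n s .code (n - 1))) := by
  refine isExtendedPerfectCode_of_hammingDist ⟨0, by positivity⟩ ?_ ?_ ?_
  · rintro _ ⟨u, hu, rfl⟩
    rw [sum_grayMap_eq_leeWeight, ZMod.natCast_eq_zero_iff_even]
    exact mem_family_even.1 (family_mono n s .code n hu)
  · rintro _ ⟨u, hu, rfl⟩ _ ⟨v, hv, rfl⟩ huv
    rw [hammingDist_grayMap, leeDist]
    have hne : u - v ≠ 0 := sub_ne_zero.2 (ne_of_apply_ne _ huv)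
    have hmem : u - v ∈ family n s .code (n - 1) := sub_mem hu hv
    cases n with
    | zero =>
      rw [family_of_neg _ _ _ _ (by simp)] at hmem
      exact absurd (AddSubgroup.mem_bot.1 hmem) hne
    | succ k =>
      have := le_leeWeight_of_mem_family (k + 1) s k _ (by simpa using hmem) hne
      rw [add_assoc, pow_add] at this
      exact Nat.le_of_mul_le_mul_left this (by positivity)
  · rw [ncard_grayImage, card_family, ← pow_succ, ← pow_add, ← binomSum_sub_two]
    rfl

end Z4RM

theorem mainTheorem1 (m s : ℕ) (hm : 1 ≤ m) (hs : s ≤ (m - 1) / 2) :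
    -- binary length, minimum distance, number of codewords
    (∀ r : ℕ, r ≤ m →
      codeLength (grayImage (RM s r m)) = 2 ^ m ∧
      HasMinLeeDist (RM s r m) (2 ^ (m - r)) ∧
      HasMinHammingDist (grayImage (RM s r m)) (2 ^ (m - r)) ∧
      Nat.card (RM s r m) = 2 ^ (∑ i ∈ Finset.range (r + 1), m.choose i) ∧
      (grayImage (RM s r m)).ncard = 2 ^ (∑ i ∈ Finset.range (r + 1), m.choose i)) ∧
    -- inclusions and extreme codes
    (∀ r : ℕ, 0 < r → r ≤ m → RM s ((r : ℤ) - 1) m ≤ RM s r m) ∧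
    (RM s 0 m : Set (Fin (2 ^ (m - 1)) → ZMod 4)) = {0, fun _ => 2} ∧
    RM s m m = ⊤ ∧
    (RM s ((m : ℤ) - 1) m : Set (Fin (2 ^ (m - 1)) → ZMod 4)) = {u | Even (leeWeight u)} ∧
    -- orders `1` and `m - 2`
    (IsZ4Linear (grayImage (RM s 1 m)) ∧ IsHadamardCode (grayImage (RM s 1 m))) ∧
    (IsZ4Linear (grayImage (RM s ((m : ℤ) - 2) m)) ∧
      IsExtendedPerfectCode (grayImage (RM s ((m : ℤ) - 2) m))) ∧
    -- duality for the Kronecker inner product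
    (∀ r : ℤ, -1 ≤ r → r ≤ m → RM s r m = kroneckerDual (RM s ((m : ℤ) - 1 - r) m)) := by
  obtain ⟨n, rfl⟩ : ∃ n, m = n + 1 := ⟨m - 1, by omega⟩
  have hRM (r : ℤ) : RM s r (n + 1) = family n s .code r := RM_succ n s r
  have e1 : ((n + 1 : ℕ) : ℤ) - 1 = n := by push_cast; ring
  have e2 : ((n + 1 : ℕ) : ℤ) - 2 = n - 1 := by push_cast; ring
  simp only [hRM, e1, e2]
  refine ⟨fun r hr => ⟨?_, hasMinLeeDist_family n s r hr,
    hasMinHammingDist_grayImage (hasMinLeeDist_family n s r hr), card_family n s r,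
    (ncard_grayImage _).trans (card_family n s r)⟩, fun r _ _ => family_mono n s .code r,
    Set.ext fun u => mem_family_zero, family_of_lt n s _ _ (by push_cast; omega),
    Set.ext fun u => mem_family_even, ⟨⟨_, rfl⟩, isHadamardCode_family n s⟩,
    ⟨⟨_, rfl⟩, isExtendedPerfectCode_family n s⟩,
    fun r _ _ => family_eq_kroneckerDual n s .code r⟩
  exact (pow_succ 2 n).symm
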